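/- Setting. Let $A\cong\mathbb C^{d_A}$, $B\cong\mathbb C^{d_B}$ be finite-dimensional Hilbert spaces, $\rho=\rho_{AB}$ a density matrix on $A\otimes B$, and $\rho_A,\rho_B$ its partial traces. A function $f:(0,\infty)\to[0,\infty)$ is a normalized operator monotone function if $f(1)=1$ and $f(P)\le f(Q)$ for all positive definite complex matrices $P\le Q$ of every size. Put $f(0^+)=\lim_{x\downarrow0}f(x)$, $f'(+\infty)=\lim_{x\to\infty}f(x)/x$, and for $x,y\ge 0$ let $P_f(x,y)=yf(x/y)$ if $x,y>0$, $P_f(0,y)=yf(0^+)$, $P_f(x,0)=xf'(+\infty)$. For a density matrix $\sigma=\sum_i\lambda_iQ_i$ (spectral decomposition with rank-one projections $Q_i$) let $\mathbf J_{f,\sigma}(X)=\sum_{i,j}P_f(\lambda_i,\lambda_j)\,Q_iXQ_j$ and $\langle X,Y\rangle_{f,\sigma}=\mathrm{Tr}[X^*\mathbf J_{f,\sigma}(Y)]$. Define $$\mu_f(A:B)_\rho=\sup\bigl|\mathrm{Tr}[(X\otimes Y^*)\rho_{AB}]\bigr|$$ over Hermitian operators $X$ on $A$ and $Y$ on $B$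 with $\langle\mathbb 1,X\rangle_{f,\rho_A}=\langle\mathbb 1,Y\rangle_{f,\rho_B}=0$ and $\langle X,X\rangle_{f,\rho_A}=\langle Y,Y\rangle_{f,\rho_B}=1$, and $\mu_f^{\mathrm{Lin}}(A:B)_\rho$ by the same formula with the supremum over all linear operators $X,Y$ satisfying these constraints; a supremum over an empty feasible set is $0$. Let $f_{GM}(x)=\sqrt x$, $f_{AM}(x)=(x+1)/2$, $\mu_{AM}=\mu_{f_{AM}}$. A two-outcome measurement is a pair $M_0,M_1\ge0$ with $M_0+M_1=\mathbb 1$, identified with the channel $\mathcal M(R)=\sum_{x}\mathrm{Tr}[M_xR]\,|x\rangle\langle x|$; it is projective if $M_0,M_1$ are orthogonal projections. For $p\in[0,1]$ let $\chi^{|p}=p\,|0\rangle\langle0|\otimes|0\rangle\langle0|+(1-p)\,|1\rangle\langle1|\otimes|1\rangle\langle1|$. Theorem. (1) For every normalized operator monotone function $f$, the suprema defining $\mu_f(A:B)_\rho$ and $\mu_f^{\mathrm{Lin}}(A:B)_\rho$ are finite; $\mu_f(A:B)_\rho\ge0$ with equality if and only if $\rho_{AB}=\rho_A\otimes\rho_B$;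 and $\mu_f^{\mathrm{Lin}}(A:B)_\rho\ge0$ with equality if and only if $\rho_{AB}=\rho_A\otimes\rho_B$. (2) For every normalized operator monotone function $f$ with $f(x)\ge f_{GM}(x)$ for all $x>0$, $\mu_f(A:B)_\rho\le\mu_f^{\mathrm{Lin}}(A:B)_\rho\le1$. (3) The following are equivalent: (i) $\mu_{AM}(A:B)_\rho=1$; (ii) there are two-outcome measurements $\mathcal M$ on $A$ and $\mathcal N$ on $B$ and $p\in(0,1)$ with $(\mathcal M\otimes\mathcal N)(\rho_{AB})=\chi^{|p}$; (iii) there are projective two-outcome measurements $\mathcal M$ on $A$ and $\mathcal N$ on $B$ and $p\in(0,1)$ with $(\mathcal M\otimes\mathcal N)(\rho_{AB})=\chi^{|p}$; (iv) there are orthogonal decompositions $A=A_0\oplus A_1$, $B=B_0\oplus B_1$, a number $p\in(0,1)$, density matrices $\rho^0$ on $A_0\otimes B_0$ and $\rho^1$ on $A_1\otimes B_1$, and a linear operator $X:A_0\otimes B_0\to A_1\otimes B_1$ (all extended by zero to $A\otimes B$) such that $\rho_{AB}=p\rho^0+(1-p)\rho^1+X+X^*$. -/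

import Mathlib

open Filter Topology
open scoped Kronecker Matrix ComplexOrder

noncomputable section

namespace QMaxCorr

/-! ### Operator monotone functions and their perspective -/

/-- `f : (0,∞) → [0,∞)` is a normalized operator monotone function. Only the values of `f` on the
open half line `(0,∞)` matter, so `f` is represented by a function on `ℝ`; `cfc f A` is the
functional calculus of the positive definite matrix `A`. (A function on `[0,∞)` that is monotone on
all positive semidefinite matrices satisfies this in particular; its value at `0` is never used.) -/
structure IsNormalizedOperatorMonotone (f : ℝ → ℝ) : Prop where
  nonneg : ∀ x : ℝ, 0 < x → 0 ≤ f x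
  normalized : f 1 = 1
  monotone : ∀ (n : ℕ) (A B : Matrix (Fin n) (Fin n) ℂ), A.PosDef → B.PosDef →
    (B - A).PosSemidef → (cfc f B - cfc f A).PosSemidef

/-- The function of the geometric mean, `x ↦ √x`. -/
def fGM : ℝ → ℝ := fun x => Real.sqrt x

/-- The function of the arithmetic mean, `x ↦ (x + 1) / 2`. -/
def fAM : ℝ → ℝ := fun x => (x + 1) / 2

/-- `f(0⁺)`, the limit of `f x` as `x ↓ 0`. -/
def limZero (f : ℝ → ℝ) : ℝ := limUnder (𝓝[>] (0 : ℝ)) f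

/-- `f'(+∞)`, the limit of `f x / x` as `x → +∞`. -/
def slopeInfty (f : ℝ → ℝ) : ℝ := limUnder atTop (fun x : ℝ => f x / x)

/-- The perspective function `P_f` on `[0,∞) × [0,∞)`. -/
def perspective (f : ℝ → ℝ) (x y : ℝ) : ℝ :=
  if x = 0 then y * limZero f
  else if y = 0 then x * slopeInfty f
  else y * f (x / y)

/-! ### States -/

/-- Density matrices (quantum states) on `ℂ^n`. -/
structure State (n : Type*) [Fintype n] where
  mat : Matrix n n ℂ
  posSemidef : mat.PosSemidef
  trace_one : mat.trace = 1

section Marginals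

variable {a b : Type*} [Fintype a] [Fintype b]

/-- The reduced state `ρ_A = Tr_B ρ_AB`. -/
def State.margA (ρ : State (a × b)) : State a where
  mat := ∑ k : b, ρ.mat.submatrix (fun i => (i, k)) (fun i => (i, k))
  posSemidef := Matrix.posSemidef_sum _ fun k _ => ρ.posSemidef.submatrix _
  trace_one := by
    rw [← ρ.trace_one, Matrix.trace_sum]
    simp only [Matrix.trace, Matrix.diag_apply, Matrix.submatrix_apply]
    rw [Fintype.sum_prod_type_right]

/-- The reduced state `ρ_B = Tr_A ρ_AB`. -/
def State.margB (ρ : State (a × b)) : State b where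
  mat := ∑ k : a, ρ.mat.submatrix (fun i => (k, i)) (fun i => (k, i))
  posSemidef := Matrix.posSemidef_sum _ fun k _ => ρ.posSemidef.submatrix _
  trace_one := by
    rw [← ρ.trace_one, Matrix.trace_sum]
    simp only [Matrix.trace, Matrix.diag_apply, Matrix.submatrix_apply]
    rw [Fintype.sum_prod_type]

end Marginals

/-! ### The operator `J_{f,σ}` and the inner product it induces -/

section JOperator

variable {n : Type*} [Fintype n] [DecidableEq n]

/-- The eigenvalues `λ_i` of a state, indexed by an orthonormal eigenbasis. -/
def State.eigval (σ : State n) (i : n) : ℝ := σ.posSemidef.isHermitian.eigenvalues i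

/-- The rank-one projection `Q_i` onto the `i`-th vector of that eigenbasis, so that
`σ = ∑ i, λ_i Q_i`. -/
def State.eigproj (σ : State n) (i : n) : Matrix n n ℂ :=
  Matrix.vecMulVec (fun k => σ.posSemidef.isHermitian.eigenvectorBasis i k)
    (star fun k => σ.posSemidef.isHermitian.eigenvectorBasis i k)

/-- `J_{f,σ}(X) = ∑ i j, P_f(λ_i, λ_j) Q_i X Q_j`. -/
def J (f : ℝ → ℝ) (σ : State n) (X : Matrix n n ℂ) : Matrix n n ℂ :=
  ∑ i, ∑ j, ((perspective f (σ.eigval i) (σ.eigval j) : ℝ) : ℂ) •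
    (σ.eigproj i * X * σ.eigproj j)

/-- `⟨X, Y⟩_{f,σ} = Tr[X* J_{f,σ}(Y)]`. -/
def innerF (f : ℝ → ℝ) (σ : State n) (X Y : Matrix n n ℂ) : ℂ :=
  (Xᴴ * J f σ Y).trace

end JOperator

/-! ### Maximal correlation coefficients -/

section MaxCorr

variable {a b : Type*} [Fintype a] [DecidableEq a] [Fintype b] [DecidableEq b]

/-- The constraints on a pair of operators in the optimization problem. -/
structure Feasible (f : ℝ → ℝ) (ρ : State (a × b)) (X : Matrix a a ℂ) (Y : Matrix b b ℂ) :
    Prop where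
  mean_left : innerF f ρ.margA 1 X = 0
  mean_right : innerF f ρ.margB 1 Y = 0
  var_left : innerF f ρ.margA X X = 1
  var_right : innerF f ρ.margB Y Y = 1

/-- The objective `|Tr[(X ⊗ Y*) ρ_AB]|`. -/
def objective (ρ : State (a × b)) (X : Matrix a a ℂ) (Y : Matrix b b ℂ) : ℝ :=
  ‖((X ⊗ₖ Yᴴ) * ρ.mat).trace‖

/-- The values of the optimization problem over Hermitian operators. -/
def valuesHerm (f : ℝ → ℝ) (ρ : State (a × b)) : Set ℝ :=
  {r | ∃ (X : Matrix a a ℂ) (Y : Matrix b b ℂ),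
    X.IsHermitian ∧ Y.IsHermitian ∧ Feasible f ρ X Y ∧ r = objective ρ X Y}

/-- The values of the optimization problem over all linear operators. -/
def valuesLin (f : ℝ → ℝ) (ρ : State (a × b)) : Set ℝ :=
  {r | ∃ (X : Matrix a a ℂ) (Y : Matrix b b ℂ), Feasible f ρ X Y ∧ r = objective ρ X Y}

/-- `μ_f(A:B)_ρ`. The supremum over an empty feasible set is `0`. -/
def mu (f : ℝ → ℝ) (ρ : State (a × b)) : ℝ := sSup (valuesHerm f ρ)

/-- `μ_f^Lin(A:B)_ρ`. The supremum over an empty feasible set is `0`. -/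
def muLin (f : ℝ → ℝ) (ρ : State (a × b)) : ℝ := sSup (valuesLin f ρ)

end MaxCorr

/-! ### Local measurements -/

section Measurements

/-- Two-outcome measurements (POVMs) on `ℂ^n`. -/
structure Measurement (n : Type*) [Fintype n] [DecidableEq n] where
  effect : Fin 2 → Matrix n n ℂ
  posSemidef : ∀ x, (effect x).PosSemidef
  sum_one : ∑ x, effect x = 1

variable {n : Type*} [Fintype n] [DecidableEq n]

/-- A measurement is projective if all its effects are orthogonal projections. -/
def Measurement.IsProjective (M : Measurement n) : Prop := ∀ x, IsStarProjection (M.effect x)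

/-- The quantum-to-classical channel `R ↦ ∑ x, Tr[M_x R] |x⟩⟨x|` of a measurement. -/
def Measurement.channel (M : Measurement n) :
    Matrix n n ℂ →ₗ[ℂ] Matrix (Fin 2) (Fin 2) ℂ where
  toFun R := ∑ x, (M.effect x * R).trace • Matrix.single x x (1 : ℂ)
  map_add' R S := by
    simp only [mul_add, Matrix.trace_add, add_smul, Finset.sum_add_distrib]
  map_smul' c R := by
    simp only [Matrix.mul_smul, Matrix.trace_smul, smul_assoc, Finset.smul_sum, RingHom.id_apply]

/-- The action of `Φ ⊗ Ψ` on an operator `R = ∑ R_{(i,k),(j,l)} E_{ij} ⊗ E_{kl}`. -/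
def tensorApply {a b a' b' : Type*} [Fintype a] [DecidableEq a] [Fintype b] [DecidableEq b]
    (Φ : Matrix a a ℂ →ₗ[ℂ] Matrix a' a' ℂ) (Ψ : Matrix b b ℂ →ₗ[ℂ] Matrix b' b' ℂ)
    (R : Matrix (a × b) (a × b) ℂ) : Matrix (a' × b') (a' × b') ℂ :=
  ∑ i, ∑ j, ∑ k, ∑ l, R (i, k) (j, l) •
    (Φ (Matrix.single i j 1) ⊗ₖ Ψ (Matrix.single k l 1))

/-- The perfectly correlated pair of bits
`χ^{|p} = p |0⟩⟨0| ⊗ |0⟩⟨0| + (1 - p) |1⟩⟨1| ⊗ |1⟩⟨1|`. -/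
def chi (p : ℝ) : Matrix (Fin 2 × Fin 2) (Fin 2 × Fin 2) ℂ :=
  (p : ℂ) • (Matrix.single 0 0 (1 : ℂ) ⊗ₖ Matrix.single 0 0 (1 : ℂ)) +
    ((1 - p : ℝ) : ℂ) • (Matrix.single 1 1 (1 : ℂ) ⊗ₖ Matrix.single 1 1 (1 : ℂ))

end Measurements

/-! ### Block decompositions -/

section Blocks

variable {a b : Type*} [Fintype a] [DecidableEq a] [Fintype b] [DecidableEq b]

/-- `V = V₀ ⊕ V₁` as Hilbert spaces. -/
def IsOrthogonalDecomposition (V₀ V₁ : Submodule ℂ (EuclideanSpace ℂ a)) : Prop :=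
  V₀ ⟂ V₁ ∧ V₀ ⊔ V₁ = ⊤

/-- The product vector `v ⊗ w`. -/
def tensorVec (v : EuclideanSpace ℂ a) (w : EuclideanSpace ℂ b) : EuclideanSpace ℂ (a × b) :=
  WithLp.toLp 2 fun p => v p.1 * w p.2

/-- The subspace `V ⊗ W` of `ℂ^a ⊗ ℂ^b = ℂ^(a × b)`. -/
def tensorSubspace (V : Submodule ℂ (EuclideanSpace ℂ a))
    (W : Submodule ℂ (EuclideanSpace ℂ b)) : Submodule ℂ (EuclideanSpace ℂ (a × b)) :=
  Submodule.span ℂ {u | ∃ v ∈ V, ∃ w ∈ W, u = tensorVec v w}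

/-- `T` is (the extension by zero of) an operator in `L(S, S')`, for subspaces `S`, `S'`:
it vanishes on the orthogonal complement of `S` and has values in `S'`. -/
def IsOperatorBetween (T : Matrix a a ℂ) (S S' : Submodule ℂ (EuclideanSpace ℂ a)) : Prop :=
  (∀ v ∈ Sᗮ, Matrix.toEuclideanLin T v = 0) ∧ ∀ v, Matrix.toEuclideanLin T v ∈ S'

/-- `ρ` has the block form `p ρ⁰ + (1 - p) ρ¹ + X + X*` with respect to orthogonal decompositions
`A = A₀ ⊕ A₁`, `B = B₀ ⊕ B₁`, with states `ρⁱ` on `Aᵢ ⊗ Bᵢ`, an operator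
`X : A₀ ⊗ B₀ → A₁ ⊗ B₁`, and `0 < p < 1`. -/
def IsDecomposable (ρ : State (a × b)) : Prop :=
  ∃ (A₀ A₁ : Submodule ℂ (EuclideanSpace ℂ a)) (B₀ B₁ : Submodule ℂ (EuclideanSpace ℂ b)),
    IsOrthogonalDecomposition A₀ A₁ ∧ IsOrthogonalDecomposition B₀ B₁ ∧
    ∃ (p : ℝ) (ρ₀ ρ₁ : State (a × b)) (X : Matrix (a × b) (a × b) ℂ),
      0 < p ∧ p < 1 ∧
      IsOperatorBetween ρ₀.mat (tensorSubspace A₀ B₀) (tensorSubspace A₀ B₀) ∧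
      IsOperatorBetween ρ₁.mat (tensorSubspace A₁ B₁) (tensorSubspace A₁ B₁) ∧
      IsOperatorBetween X (tensorSubspace A₀ B₀) (tensorSubspace A₁ B₁) ∧
      ρ.mat = (p : ℂ) • ρ₀.mat + ((1 - p : ℝ) : ℂ) • ρ₁.mat + X + Xᴴ

end Blocks

end QMaxCorr

end

open QMaxCorr

/-!
In the eigenbases of the marginals `σ = ρ_A` and `τ = ρ_B`, with eigenvalues `λ_i` and `μ_k`, the
form `⟨X, X⟩_{f,σ}` is the weighted sum `∑ P_f(λ_i, λ_j) |X_ij|²`, and `⟨1, X⟩_{f,σ} = Tr[σ X]`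
because `P_f(x, x) = x`.

*The Cauchy–Schwarz inequality of the geometric mean.* Everything quantitative follows from
`|Tr[(X ⊗ Y*) ρ]|² ≤ (∑ √(λ_i λ_j) |X_ij|²) (∑ √(μ_k μ_l) |Y_kl|²)` (`objective_sq_le`). After a
regularization the marginals are invertible, and the bilinear form on the left is represented, for
the weighted inner products on the right, by the map
`T X = τ^{-1/2} Tr_A[(X ⊗ 1) ρ] τ^{-1/2}` (`scaledSlice`). Both `T` and its adjoint `T'` are
positive and unital (`posSemidef_scaledSlice`, `scaledSlice_one`), so `T' T` preserves the faithful
positive functional `Z ↦ Tr[σ Z]` and its powers have bounded orbits (`exists_wSq_orbit_le`). As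
`‖(T' T)^n X‖²` is log-convex in `n`, bounded orbits force `‖T X‖ ≤ ‖X‖` (`wSq_map_le`).

*Operator monotone functions.* Scalar matrices show that `f` is increasing, and `2 × 2` matrices
that `f x / x` is decreasing (`IsNormalizedOperatorMonotone.mul_le_mul`). Hence the limits `f(0⁺)`
and `f'(+∞)` exist, `P_f` is nonnegative, and it is positive on positive arguments. So the weights
`√(λ_i λ_j)` are bounded by a multiple of `P_f(λ_i, λ_j)`, which gives finiteness and shows that operators of zero
variance are uncorrelated with everything; if all centered Hermitian operators are uncorrelated,
then `ρ` is a product (`product_of_uncorrelated`). If `f ≥ √`, then `P_f(x, y) ≥ √(x y)` and the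
inequality bounds `μ_f^Lin` by one.

*The extremal case.* If `μ_AM = 1`, compactness after compression to the supports of the marginals
yields Hermitian `X`, `Y` of variance at most one with `Tr[(X ⊗ Y) ρ] ≥ 1`. Then
`Tr[(X ⊗ 1 - 1 ⊗ Y)² ρ] ≤ 0`, so `(X ⊗ 1) ρ = (1 ⊗ Y) ρ`, and the same holds for functions of `X`
and `Y` (`cfc_kronecker_mul_eq`). The spectral projections of `X` and `Y` onto `(0, ∞)` are
perfectly correlated, and they are nontrivial because `X` is centered. Conversely, perfectly
correlated measurements give two-valued observables with variance at most one and correlation one.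
The block decomposition is a restatement for the ranges of the projections.
-/

open QMaxCorr

namespace QMaxCorr

/-! ### Scalar properties of operator monotone functions -/

/-- The functional calculus of a matrix with at most two eigenvalues `t`, `r` is given by linear
interpolation. -/
lemma cfc_smul_one_add_smul_proj {n : Type*} [Fintype n] [DecidableEq n] (f : ℝ → ℝ) (t r : ℝ)
    {P : Matrix n n ℂ} (hP : IsStarProjection P) :
    cfc f (t • (1 : Matrix n n ℂ) + (r - t) • P) = f t • (1 : Matrix n n ℂ) + (f r - f t) • P := by
  set A : Matrix n n ℂ := t • (1 : Matrix n n ℂ) + (r - t) • P with hA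
  have hsa : IsSelfAdjoint A :=
    ((IsSelfAdjoint.all t).smul (IsSelfAdjoint.one _)).add
      ((IsSelfAdjoint.all _).smul hP.isSelfAdjoint)
  set α : ℝ := (f r - f t) / (r - t) with hα
  have hα' : α * (r - t) = f r - f t := by
    rcases eq_or_ne r t with rfl | h
    · simp
    · rw [hα, div_mul_cancel₀ _ (sub_ne_zero.2 h)]
  have hprod : (A - t • 1) * (A - r • 1) = 0 := by
    have h1 : A - t • 1 = (r - t) • P := by rw [hA]; abel
    have h2 : A - r • 1 = (r - t) • (P - 1) := by
      rw [hA, smul_sub, sub_smul, sub_smul]; abel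
    rw [h1, h2, smul_mul_smul_comm, mul_sub P, hP.isIdempotentElem.eq]
    simp
  have hspec : ∀ z ∈ spectrum ℝ A, z = t ∨ z = r := by
    intro z hz
    have := spectrum.subset_polynomial_aeval (𝕜 := ℝ) A
      ((Polynomial.X - Polynomial.C t) * (Polynomial.X - Polynomial.C r)) ⟨z, hz, rfl⟩
    have h0 : (Polynomial.aeval A)
        ((Polynomial.X - Polynomial.C t) * (Polynomial.X - Polynomial.C r)) = 0 := by
      simpa [Algebra.algebraMap_eq_smul_one] using hprod
    rw [h0] at this
    have hne : Nontrivial (Matrix n n ℂ) := by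
      by_contra hc
      rw [not_nontrivial_iff_subsingleton] at hc
      exact absurd (spectrum.of_subsingleton (R := ℝ) A ▸ hz) (by simp)
    rw [spectrum.zero_eq] at this
    simpa [sub_eq_zero] using this
  have hcongr : cfc f A = cfc (fun z => α * z + (f t - α * t)) A := by
    refine cfc_congr fun z hz => ?_
    rcases hspec z hz with rfl | rfl
    · ring
    · linear_combination -hα'
  rw [hcongr, cfc_add .., cfc_const_mul .., cfc_id' ℝ A, cfc_const _ A, hA,
    Algebra.algebraMap_eq_smul_one, smul_add, smul_smul, smul_smul, hα',
    sub_smul _ _ (1 : Matrix n n ℂ)]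
  abel

lemma isStarProjection_vecMulVec {n : Type*} [Fintype n] {w : n → ℂ} (hw : star w ⬝ᵥ w = 1) :
    IsStarProjection (Matrix.vecMulVec w (star w)) := by
  refine ⟨?_, ?_⟩
  · rw [IsIdempotentElem, Matrix.vecMulVec_mul_vecMulVec, hw, one_smul]
  · exact (Matrix.posSemidef_vecMulVec_self_star w).isHermitian

namespace IsNormalizedOperatorMonotone

variable {f : ℝ → ℝ}

lemma mono (hf : IsNormalizedOperatorMonotone f) {x y : ℝ} (hx : 0 < x) (hxy : x ≤ y) :
    f x ≤ f y := by
  have hpd : ∀ t : ℝ, 0 < t → (t • (1 : Matrix (Fin 1) (Fin 1) ℂ)).PosDef := fun t ht =>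
    Matrix.PosDef.one.smul ht
  have hc : ∀ t : ℝ, cfc f (t • (1 : Matrix (Fin 1) (Fin 1) ℂ)) = f t • 1 := fun t => by
    simpa using cfc_smul_one_add_smul_proj f t t
      (IsStarProjection.zero (R := Matrix (Fin 1) (Fin 1) ℂ))
  have h := hf.monotone 1 _ _ (hpd x hx) (hpd y (hx.trans_le hxy))
    (by rw [← sub_smul]; exact Matrix.PosSemidef.one.smul (sub_nonneg.2 hxy))
  rw [hc, hc, ← sub_smul] at h
  have := h.diag_nonneg (i := 0)
  simp only [Matrix.smul_apply, Matrix.one_apply_eq, Complex.real_smul, mul_one] at this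
  rw [Complex.zero_le_real] at this
  linarith

/-- Operator monotone functions are concave up to an arbitrarily small shift of the argument. A
`2 × 2` matrix with eigenvalues `x`, `y` and upper left entry `s x + (1 - s) y` is dominated by a
diagonal matrix with upper left entry `s x + (1 - s) y + ε`. -/
lemma almost_concave (hf : IsNormalizedOperatorMonotone f) {x y s ε : ℝ} (hy : 0 < y)
    (hyx : y ≤ x) (hs0 : 0 ≤ s) (hs1 : s ≤ 1) (hε : 0 < ε) :
    s * f x + (1 - s) * f y ≤ f (s * x + (1 - s) * y + ε) := by
  set u : ℝ := s * x + (1 - s) * y + ε with hu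
  set c : ℝ := (x - y) * (√s * √(1 - s)) with hc
  -- the lower right entry of the dominating diagonal matrix
  set L : ℝ := (1 - s) * x + s * y + c ^ 2 / ε with hL
  have hss : √s * √s = s := Real.mul_self_sqrt hs0
  have hss' : √(1 - s) * √(1 - s) = 1 - s := Real.mul_self_sqrt (by linarith)
  have hupos : 0 < u := by
    have : 0 ≤ s * (x - y) := mul_nonneg hs0 (by linarith)
    rw [hu]; nlinarith
  have hLpos : 0 < L := by
    have : 0 ≤ (1 - s) * (x - y) := mul_nonneg (by linarith) (by linarith)
    have : 0 ≤ c ^ 2 / ε := by positivity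
    rw [hL]; nlinarith
  let w : Fin 2 → ℂ := ![(√s : ℂ), (√(1 - s) : ℂ)]
  let e : Fin 2 → ℂ := ![0, 1]
  have hw : star w ⬝ᵥ w = 1 := by
    simp only [w, dotProduct, Fin.sum_univ_two, Pi.star_apply, Matrix.cons_val_zero,
      Matrix.cons_val_one, RCLike.star_def, Complex.conj_ofReal]
    rw [← Complex.ofReal_mul, ← Complex.ofReal_mul, hss, hss']
    push_cast; ring
  have he : star e ⬝ᵥ e = 1 := by simp [e, dotProduct]
  have hMpd : (y • (1 : Matrix (Fin 2) (Fin 2) ℂ)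
      + (x - y) • Matrix.vecMulVec w (star w)).PosDef :=
    (Matrix.PosDef.one.smul hy).add_posSemidef
      ((Matrix.posSemidef_vecMulVec_self_star w).smul (by linarith : (0 : ℝ) ≤ x - y))
  have hw0 : w 0 = √s := rfl
  have hw1 : w 1 = √(1 - s) := rfl
  have he0 : e 0 = 0 := rfl
  have he1 : e 1 = 1 := rfl
  have e1 : (√s : ℂ) * √s = (s : ℝ) := by rw [← Complex.ofReal_mul, hss]
  have e2 : (√(1 - s) : ℂ) * √(1 - s) = (1 - s : ℝ) := by rw [← Complex.ofReal_mul, hss']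
  have hBdiag : u • (1 : Matrix (Fin 2) (Fin 2) ℂ) + (L - u) • Matrix.vecMulVec e (star e)
      = Matrix.diagonal ![(u : ℂ), (L : ℂ)] := by
    ext i j
    fin_cases i <;> fin_cases j <;> simp [he0, he1, Matrix.vecMulVec_apply]
  have hBpd : (u • (1 : Matrix (Fin 2) (Fin 2) ℂ)
      + (L - u) • Matrix.vecMulVec e (star e)).PosDef := by
    rw [hBdiag, Matrix.posDef_diagonal_iff]
    intro i
    fin_cases i
    · simpa using hupos
    · simpa using hLpos
  let v : Fin 2 → ℂ := ![1, ((-(c / ε) : ℝ) : ℂ)]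
  have hdiff : (u • (1 : Matrix (Fin 2) (Fin 2) ℂ) + (L - u) • Matrix.vecMulVec e (star e))
      - (y • (1 : Matrix (Fin 2) (Fin 2) ℂ) + (x - y) • Matrix.vecMulVec w (star w))
      = ε • Matrix.vecMulVec v (star v) := by
    have hε' : ε ≠ 0 := hε.ne'
    have hv0 : v 0 = 1 := rfl
    have hv1 : v 1 = ((-(c / ε) : ℝ) : ℂ) := rfl
    rw [hBdiag]
    ext i j
    fin_cases i <;> fin_cases j
    · simp [hv0, hw0, Matrix.vecMulVec_apply, e1, hu]; ring
    · simp [hv0, hv1, hw0, hw1, Matrix.vecMulVec_apply, hc]; field_simp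
    · simp [hv0, hv1, hw0, hw1, Matrix.vecMulVec_apply, hc]; field_simp
    · simp [hv1, hw1, Matrix.vecMulVec_apply, e2, hL]; field_simp; ring
  have h := hf.monotone 2 _ _ hMpd hBpd
    (by rw [hdiff]; exact (Matrix.posSemidef_vecMulVec_self_star v).smul hε.le)
  rw [cfc_smul_one_add_smul_proj f _ _ (isStarProjection_vecMulVec hw),
    cfc_smul_one_add_smul_proj f _ _ (isStarProjection_vecMulVec he)] at h
  have h0 := h.diag_nonneg (i := 0)
  simp [Matrix.vecMulVec_apply, he0, hw0, e1] at h0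
  rw [← Complex.ofReal_sub, ← Complex.ofReal_mul, ← Complex.ofReal_add, Complex.real_le_real] at h0
  linarith

/-- `x ↦ f x / x` is decreasing. -/
lemma mul_le_mul (hf : IsNormalizedOperatorMonotone f) {u v : ℝ} (hu : 0 < u) (huv : u ≤ v) :
    u * f v ≤ v * f u := by
  have hv : 0 < v := hu.trans_le huv
  rcases (hf.nonneg v hv).eq_or_lt with h0 | hpos
  · rw [← h0, mul_zero]; exact mul_nonneg hv.le (hf.nonneg u hu)
  by_contra! hlt
  -- concavity is used with a weight `s` strictly between `f u / f v` and `u / v`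
  set s : ℝ := (u / v + f u / f v) / 2 with hs
  have h1 : f u / f v < u / v := by
    rw [div_lt_div_iff₀ hpos hv]; linarith
  have h1' : 0 ≤ f u / f v := div_nonneg (hf.nonneg u hu) hpos.le
  have h2 : s < u / v := by rw [hs]; linarith
  have h3 : f u / f v < s := by rw [hs]; linarith
  have h4 : s * v < u := by rwa [lt_div_iff₀ hv] at h2
  have h5 : f u < s * f v := by rwa [div_lt_iff₀ hpos] at h3
  have hs0 : 0 ≤ s := h1'.trans h3.le
  have hs1 : s ≤ 1 := h2.le.trans ((div_le_one hv).2 huv)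
  set y : ℝ := (u - s * v) / 2 with hy
  have hy0 : 0 < y := by rw [hy]; linarith
  have hyv : y ≤ v := by
    have : 0 ≤ s * v := mul_nonneg hs0 hv.le
    rw [hy]; linarith
  have h := hf.almost_concave (x := v) (y := y) (s := s) (ε := u - s * v - (1 - s) * y) hy0 hyv hs0
    hs1 (by nlinarith)
  rw [show s * v + (1 - s) * y + (u - s * v - (1 - s) * y) = u by ring] at h
  have : 0 ≤ (1 - s) * f y := mul_nonneg (by linarith) (hf.nonneg y hy0)
  linarith

lemma min_le (hf : IsNormalizedOperatorMonotone f) {x : ℝ} (hx : 0 < x) : min x 1 ≤ f x := by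
  rcases le_total x 1 with h | h
  · rw [min_eq_left h]
    simpa [hf.normalized] using hf.mul_le_mul hx h
  · rw [min_eq_right h]
    simpa [hf.normalized] using hf.mono one_pos h

lemma pos (hf : IsNormalizedOperatorMonotone f) {x : ℝ} (hx : 0 < x) : 0 < f x :=
  (lt_min hx one_pos).trans_le (hf.min_le hx)

/-- Monotonicity provides the limit, without which `limUnder` would be an arbitrary number. -/
lemma limZero_nonneg (hf : IsNormalizedOperatorMonotone f) : 0 ≤ limZero f := by
  have hlim : ∃ l, Tendsto f (𝓝[>] (0 : ℝ)) (𝓝 l) := by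
    refine ⟨_, MonotoneOn.tendsto_nhdsGT (x := 0) ?_ ?_⟩
    · exact fun x hx y _ hxy => hf.mono hx hxy
    · exact ⟨0, by rintro _ ⟨x, hx, rfl⟩; exact hf.nonneg x hx⟩
  refine ge_of_tendsto (tendsto_nhds_limUnder hlim) ?_
  filter_upwards [self_mem_nhdsWithin] with x hx using hf.nonneg x hx

/-- The limit exists because `f x / x` is decreasing and nonnegative. -/
lemma slopeInfty_nonneg (hf : IsNormalizedOperatorMonotone f) : 0 ≤ slopeInfty f := by
  have hlim : ∃ l, Tendsto (fun x => f x / x) atTop (𝓝 l) := by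
    -- extend `f x / x` by its value at `1` to an antitone function on the whole line
    set g : ℝ → ℝ := fun x => f (max x 1) / max x 1 with hg
    have hpos : ∀ x : ℝ, 0 < max x 1 := fun x => one_pos.trans_le (le_max_right _ _)
    have hanti : Antitone g := by
      intro x y hxy
      have := hf.mul_le_mul (hpos x) (max_le_max_right 1 hxy)
      simp only [hg]
      rw [div_le_div_iff₀ (hpos y) (hpos x)]
      linarith
    have hbdd : BddBelow (Set.range g) :=
      ⟨0, by rintro _ ⟨x, rfl⟩; exact div_nonneg (hf.nonneg _ (hpos x)) (hpos x).le⟩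
    refine ⟨_, (tendsto_atTop_ciInf hanti hbdd).congr' ?_⟩
    filter_upwards [eventually_ge_atTop 1] with x hx
    simp only [hg]
    rw [max_eq_left hx]
  refine ge_of_tendsto (tendsto_nhds_limUnder hlim) ?_
  filter_upwards [eventually_gt_atTop 0] with x hx using div_nonneg (hf.nonneg x hx) hx.le

lemma perspective_nonneg (hf : IsNormalizedOperatorMonotone f) {x y : ℝ} (hx : 0 ≤ x)
    (hy : 0 ≤ y) : 0 ≤ perspective f x y := by
  unfold perspective
  split_ifs with h1 h2
  · exact mul_nonneg hy hf.limZero_nonneg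
  · exact mul_nonneg hx hf.slopeInfty_nonneg
  · exact mul_nonneg hy (hf.nonneg _ (div_pos (lt_of_le_of_ne hx (Ne.symm h1))
      (lt_of_le_of_ne hy (Ne.symm h2))))

lemma perspective_pos (hf : IsNormalizedOperatorMonotone f) {x y : ℝ} (hx : 0 < x)
    (hy : 0 < y) : 0 < perspective f x y := by
  unfold perspective
  rw [if_neg hx.ne', if_neg hy.ne']
  exact mul_pos hy (hf.pos (div_pos hx hy))

lemma sqrt_mul_le_perspective (hf : IsNormalizedOperatorMonotone f)
    (hgm : ∀ x : ℝ, 0 < x → fGM x ≤ f x) {x y : ℝ} (hx : 0 ≤ x) (hy : 0 ≤ y) :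
    √(x * y) ≤ perspective f x y := by
  rcases hx.eq_or_lt with rfl | hx'
  · simpa using hf.perspective_nonneg le_rfl hy
  rcases hy.eq_or_lt with rfl | hy'
  · simpa using hf.perspective_nonneg hx le_rfl
  unfold perspective
  rw [if_neg hx'.ne', if_neg hy'.ne']
  have h : y * √(x / y) = √(x * y) := by
    rw [show x * y = y ^ 2 * (x / y) by field_simp, Real.sqrt_mul (sq_nonneg y), Real.sqrt_sq hy]
  rw [← h]
  exact mul_le_mul_of_nonneg_left (hgm _ (div_pos hx' hy')) hy

end IsNormalizedOperatorMonotone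

lemma perspective_self {f : ℝ → ℝ} (hf : f 1 = 1) (x : ℝ) : perspective f x x = x := by
  unfold perspective
  split_ifs with h
  · simp [h]
  · rw [div_self h, hf, mul_one]

lemma perspective_fAM (x y : ℝ) : perspective fAM x y = (x + y) / 2 := by
  have h0 : limZero fAM = 1 / 2 := by
    refine Tendsto.limUnder_eq ?_
    have : Tendsto fAM (𝓝 0) (𝓝 (fAM 0)) := by
      have : Continuous fAM := by unfold fAM; fun_prop
      exact this.tendsto 0
    simpa [fAM] using this.mono_left nhdsWithin_le_nhds
  have h1 : slopeInfty fAM = 1 / 2 := by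
    refine Tendsto.limUnder_eq ?_
    have : Tendsto (fun x : ℝ => 1 / 2 + (1 / 2) * x⁻¹) atTop (𝓝 (1 / 2 + (1 / 2) * 0)) :=
      (tendsto_inv_atTop_zero.const_mul _).const_add _
    rw [mul_zero, add_zero] at this
    refine this.congr' ?_
    filter_upwards [eventually_gt_atTop 0] with x hx
    unfold fAM
    field_simp
  unfold perspective
  split_ifs with hx hy
  · rw [h0, hx]; ring
  · rw [h1, hy]; ring
  · unfold fAM; field_simp

/-! ### Weighted Hilbert–Schmidt forms -/

section Weighted

variable {n : Type*} [Fintype n]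

/-- The weighted Hilbert–Schmidt form `∑ i j, w i j * conj (X i j) * Y i j`. -/
noncomputable def wInner (w : n → n → ℝ) (X Y : Matrix n n ℂ) : ℂ :=
  ∑ i, ∑ j, (w i j : ℂ) * (star (X i j) * Y i j)

/-- The quadratic form of `wInner`. -/
noncomputable def wSq (w : n → n → ℝ) (X : Matrix n n ℂ) : ℝ := ∑ i, ∑ j, w i j * ‖X i j‖ ^ 2

lemma wInner_self (w : n → n → ℝ) (X : Matrix n n ℂ) : wInner w X X = (wSq w X : ℂ) := by
  simp only [wInner, wSq, Complex.ofReal_sum, Complex.ofReal_mul, Complex.ofReal_pow]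
  refine Finset.sum_congr rfl fun i _ => Finset.sum_congr rfl fun j _ => ?_
  rw [← Complex.conj_mul']; rfl

lemma star_wInner (w : n → n → ℝ) (X Y : Matrix n n ℂ) :
    star (wInner w X Y) = wInner w Y X := by
  simp only [wInner, star_sum, star_mul', RCLike.star_def, Complex.conj_ofReal,
    Complex.conj_conj, mul_comm]

lemma wSq_nonneg {w : n → n → ℝ} (hw : ∀ i j, 0 ≤ w i j) (X : Matrix n n ℂ) : 0 ≤ wSq w X :=
  Finset.sum_nonneg fun i _ => Finset.sum_nonneg fun j _ => mul_nonneg (hw i j) (sq_nonneg _)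

lemma wSq_mono {w w' : n → n → ℝ} (h : ∀ i j, w i j ≤ w' i j) (X : Matrix n n ℂ) :
    wSq w X ≤ wSq w' X :=
  Finset.sum_le_sum fun i _ => Finset.sum_le_sum fun j _ =>
    mul_le_mul_of_nonneg_right (h i j) (sq_nonneg _)

lemma wSq_const_mul (c : ℝ) (w : n → n → ℝ) (X : Matrix n n ℂ) :
    wSq (fun i j => c * w i j) X = c * wSq w X := by
  simp only [wSq, Finset.mul_sum, mul_assoc]

lemma norm_wInner_sq_le {w : n → n → ℝ} (hw : ∀ i j, 0 ≤ w i j) (X Y : Matrix n n ℂ) :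
    ‖wInner w X Y‖ ^ 2 ≤ wSq w X * wSq w Y := by
  have hsq : ∀ Z : Matrix n n ℂ, wSq w Z = ∑ p : n × n, (√(w p.1 p.2) * ‖Z p.1 p.2‖) ^ 2 := by
    intro Z
    rw [wSq, Fintype.sum_prod_type]
    simp only [mul_pow, Real.sq_sqrt (hw _ _)]
  have hle : ‖wInner w X Y‖
      ≤ ∑ p : n × n, (√(w p.1 p.2) * ‖X p.1 p.2‖) * (√(w p.1 p.2) * ‖Y p.1 p.2‖) := by
    rw [wInner, ← Fintype.sum_prod_type (f := fun p : n × n =>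
      (w p.1 p.2 : ℂ) * (star (X p.1 p.2) * Y p.1 p.2))]
    refine (norm_sum_le _ _).trans (Finset.sum_le_sum fun p _ => le_of_eq ?_)
    rw [norm_mul, norm_mul, norm_star, Complex.norm_real, Real.norm_of_nonneg (hw _ _)]
    linear_combination (-(‖X p.1 p.2‖ * ‖Y p.1 p.2‖)) * Real.mul_self_sqrt (hw p.1 p.2)
  calc ‖wInner w X Y‖ ^ 2 ≤ _ := pow_le_pow_left₀ (norm_nonneg _) hle 2
    _ ≤ _ := Finset.sum_mul_sq_le_sq_mul_sq _ _ _
    _ = _ := by rw [hsq, hsq]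

end Weighted

/-- A bounded nonnegative log-convex sequence does not increase at its first step. -/
lemma le_of_logConvex_of_bounded {r : ℕ → ℝ} (h0 : ∀ n, 0 ≤ r n)
    (hconv : ∀ n, r (n + 1) ^ 2 ≤ r n * r (n + 2)) {C : ℝ} (hC : ∀ n, r n ≤ C) : r 1 ≤ r 0 := by
  by_contra! hlt
  have hr1 : 0 < r 1 := (h0 0).trans_lt hlt
  have hr0 : 0 < r 0 := by
    refine (h0 0).lt_of_ne fun h => ?_
    have := hconv 0
    rw [← h, zero_mul] at this
    nlinarith
  have key : ∀ n, 0 < r n ∧ r 1 * r n ≤ r 0 * r (n + 1) := by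
    intro n
    induction n with
    | zero => exact ⟨hr0, by linarith [mul_comm (r 0) (r 1)]⟩
    | succ n ih =>
      obtain ⟨hp, hle⟩ := ih
      have hp' : 0 < r (n + 1) := by
        have : 0 < r 0 * r (n + 1) := (mul_pos hr1 hp).trans_le hle
        exact pos_of_mul_pos_right this hr0.le
      refine ⟨hp', ?_⟩
      have h2 := hconv n
      have : r n * (r 1 * r (n + 1)) ≤ r n * (r 0 * r (n + 1 + 1)) := by
        calc r n * (r 1 * r (n + 1)) = (r 1 * r n) * r (n + 1) := by ring
          _ ≤ (r 0 * r (n + 1)) * r (n + 1) := mul_le_mul_of_nonneg_right hle hp'.le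
          _ = r 0 * r (n + 1) ^ 2 := by ring
          _ ≤ r 0 * (r n * r (n + 2)) := mul_le_mul_of_nonneg_left h2 hr0.le
          _ = r n * (r 0 * r (n + 1 + 1)) := by ring
      exact le_of_mul_le_mul_left this hp
  have hgrow : ∀ n, (r 1 / r 0) ^ n * r 0 ≤ r n := by
    intro n
    induction n with
    | zero => simp
    | succ n ih =>
      have := (key n).2
      calc (r 1 / r 0) ^ (n + 1) * r 0 = (r 1 / r 0) * ((r 1 / r 0) ^ n * r 0) := by ring
        _ ≤ (r 1 / r 0) * r n := mul_le_mul_of_nonneg_left ih (by positivity)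
        _ ≤ r (n + 1) := by rw [div_mul_eq_mul_div, div_le_iff₀ hr0]; linarith
  obtain ⟨n, hn⟩ := pow_unbounded_of_one_lt (C / r 0) ((one_lt_div hr0).2 hlt)
  rw [div_lt_iff₀ hr0] at hn
  exact absurd (hn.trans_le ((hgrow n).trans (hC n))) (lt_irrefl _)

/-- A map `T` with adjoint `T'` is a contraction as soon as the powers of `T' T` have bounded
orbits. -/
lemma wSq_map_le {a b : Type*} [Fintype a] [Fintype b] {v : a → a → ℝ} {w : b → b → ℝ}
    (hv : ∀ i j, 0 ≤ v i j) (hw : ∀ k l, 0 ≤ w k l)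
    (T : Matrix a a ℂ →ₗ[ℂ] Matrix b b ℂ) (T' : Matrix b b ℂ →ₗ[ℂ] Matrix a a ℂ)
    (hadj : ∀ X Y, wInner w Y (T X) = star (wInner v X (T' Y))) (X : Matrix a a ℂ)
    (hbdd : ∃ C : ℝ, ∀ m : ℕ, wSq v (((T' ∘ₗ T) ^ m) X) ≤ C) :
    wSq w (T X) ≤ wSq v X := by
  have hTT : ∀ Z, wSq w (T Z) ^ 2 ≤ wSq v Z * wSq v (T' (T Z)) := by
    intro Z
    have h := norm_wInner_sq_le hv Z (T' (T Z))
    have h2 := hadj Z (T Z)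
    rw [wInner_self] at h2
    rw [← norm_star, ← h2, Complex.norm_real, Real.norm_eq_abs, sq_abs] at h
    exact h
  have hsymm : ∀ Z, wSq v (T' (T Z)) ^ 2 ≤ wSq v Z * wSq v (T' (T (T' (T Z)))) := by
    intro Z
    have h := norm_wInner_sq_le hv Z (T' (T (T' (T Z))))
    have h1 := hadj Z (T (T' (T Z)))
    have h2 := hadj (T' (T Z)) (T Z)
    rw [wInner_self] at h2
    have e : ‖wInner v Z (T' (T (T' (T Z))))‖ = |wSq v (T' (T Z))| := by
      rw [← norm_star, ← h1, ← star_wInner, norm_star, h2, norm_star, Complex.norm_real,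
        Real.norm_eq_abs]
    rwa [e, sq_abs] at h
  obtain ⟨C, hC⟩ := hbdd
  have hstep : ∀ m, ((T' ∘ₗ T) ^ (m + 1)) X = T' (T (((T' ∘ₗ T) ^ m) X)) := fun m => by
    rw [pow_succ', Module.End.mul_apply, LinearMap.comp_apply]
  have h10 := le_of_logConvex_of_bounded (r := fun m => wSq v (((T' ∘ₗ T) ^ m) X))
    (fun m => wSq_nonneg hv _)
    (fun m => by
      have := hsymm (((T' ∘ₗ T) ^ m) X)
      rw [← hstep, ← hstep] at this
      exact this) hC
  simp only [pow_one, pow_zero, LinearMap.comp_apply, Module.End.one_apply] at h10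
  have h := hTT X
  have hX := wSq_nonneg hv X
  have hTX := wSq_nonneg hw (T X)
  nlinarith

/-! ### The Cauchy–Schwarz inequality of the geometric mean -/

section PosSemidef

variable {n : Type*} [Fintype n]

open scoped Matrix.Norms.L2Operator MatrixOrder in
lemma span_posSemidef [DecidableEq n] :
    Submodule.span ℂ {X : Matrix n n ℂ | X.PosSemidef} = ⊤ := by
  rw [← CStarAlgebra.span_nonneg (A := Matrix n n ℂ)]
  congr 1
  ext X
  exact Matrix.nonneg_iff_posSemidef.symm

lemma exists_eq_conjTranspose_mul_self {X : Matrix n n ℂ} (hX : X.PosSemidef) :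
    ∃ C : Matrix n n ℂ, X = Cᴴ * C := by
  classical
  open scoped MatrixOrder in
  exact CStarAlgebra.nonneg_iff_eq_star_mul_self.mp hX.nonneg

lemma norm_entry_le {X : Matrix n n ℂ} (hX : X.PosSemidef) (i j : n) :
    ‖X i j‖ ≤ (X i i).re + (X j j).re := by
  obtain ⟨C, rfl⟩ := exists_eq_conjTranspose_mul_self hX
  have hd : ∀ i, ((Cᴴ * C) i i).re = ∑ m, ‖C m i‖ ^ 2 := by
    intro i
    simp only [Matrix.mul_apply, Matrix.conjTranspose_apply, RCLike.star_def, Complex.conj_mul',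
      Complex.re_sum]
    exact Finset.sum_congr rfl fun m _ => by rw [← Complex.ofReal_pow, Complex.ofReal_re]
  rw [hd, hd, ← Finset.sum_add_distrib, Matrix.mul_apply]
  refine (norm_sum_le _ _).trans (Finset.sum_le_sum fun m _ => ?_)
  rw [norm_mul, Matrix.conjTranspose_apply, norm_star]
  nlinarith [sq_nonneg (‖C m i‖ - ‖C m j‖), sq_nonneg ‖C m i‖, sq_nonneg ‖C m j‖]

lemma trace_mul_nonneg {X Y : Matrix n n ℂ} (hX : X.PosSemidef) (hY : Y.PosSemidef) :
    0 ≤ (X * Y).trace := by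
  obtain ⟨C, rfl⟩ := exists_eq_conjTranspose_mul_self hX
  rw [Matrix.mul_assoc, Matrix.trace_mul_comm]
  exact (hY.mul_mul_conjTranspose_same C).trace_nonneg

end PosSemidef

section Slice

variable {a b : Type*} [Fintype a]

/-- `Tr_A[(X ⊗ 1) R]`. -/
noncomputable def slice (R : Matrix (a × b) (a × b) ℂ) (X : Matrix a a ℂ) : Matrix b b ℂ :=
  Matrix.of fun k l => ∑ i, ∑ j, X i j * R (j, k) (i, l)

/-- `R` with its two tensor factors exchanged. -/
abbrev swapFactors (R : Matrix (a × b) (a × b) ℂ) : Matrix (b × a) (b × a) ℂ :=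
  R.submatrix Prod.swap Prod.swap

/-- The completely positive map `X ↦ Tr_A[(X ⊗ 1) R]`, compressed on both sides by
`diag(m)^{-1/2}`. It is unital when `R` has marginal `diag(m)` on `B`. -/
noncomputable def scaledSlice (R : Matrix (a × b) (a × b) ℂ) (m : b → ℝ) :
    Matrix a a ℂ →ₗ[ℂ] Matrix b b ℂ where
  toFun X := Matrix.of fun k l => ((√(m k * m l))⁻¹ : ℝ) * slice R X k l
  map_add' X Y := by
    ext k l
    simp only [slice, Matrix.of_apply, Matrix.add_apply, add_mul, Finset.sum_add_distrib, mul_add]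
  map_smul' c X := by
    ext k l
    simp only [slice, Matrix.of_apply, Matrix.smul_apply, smul_eq_mul, RingHom.id_apply,
      mul_assoc, Finset.mul_sum, mul_left_comm]

lemma scaledSlice_apply (R : Matrix (a × b) (a × b) ℂ) (m : b → ℝ) (X : Matrix a a ℂ) (k l : b) :
    scaledSlice R m X k l = ((√(m k * m l))⁻¹ : ℝ) * slice R X k l := rfl

lemma scaledSlice_one [DecidableEq a] [DecidableEq b] {R : Matrix (a × b) (a × b) ℂ} {m : b → ℝ}
    (hm : ∀ k, 0 < m k) (hmarg : ∀ k l, ∑ i, R (i, k) (i, l) = if k = l then (m k : ℂ) else 0) :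
    scaledSlice R m 1 = 1 := by
  ext k l
  have : slice R 1 k l = if k = l then (m k : ℂ) else 0 := by
    rw [← hmarg, slice, Matrix.of_apply]
    refine Finset.sum_congr rfl fun i _ => ?_
    simp [Matrix.one_apply]
  rw [scaledSlice_apply, this, Matrix.one_apply]
  split_ifs with h
  · subst h
    rw [Real.sqrt_mul_self (hm k).le, ← Complex.ofReal_mul, inv_mul_cancel₀ (hm k).ne',
      Complex.ofReal_one]
  · rw [mul_zero]

variable [Fintype b]

/-- `Tr[(X ⊗ Y*) R]` is the Hilbert–Schmidt inner product of `Y` and `slice R X`. -/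
lemma trace_kronecker_mul (R : Matrix (a × b) (a × b) ℂ) (X : Matrix a a ℂ) (Y : Matrix b b ℂ) :
    ((X ⊗ₖ Yᴴ) * R).trace = ∑ k, ∑ l, star (Y k l) * slice R X k l := by
  simp only [Matrix.trace, Matrix.diag_apply, Matrix.mul_apply, Fintype.sum_prod_type,
    Matrix.kronecker_apply, slice, Matrix.of_apply, Finset.mul_sum, Matrix.conjTranspose_apply]
  calc _ = ∑ i, ∑ l, ∑ k, ∑ j, X i j * star (Y k l) * R (j, k) (i, l) :=
        Finset.sum_congr rfl fun i _ => Finset.sum_congr rfl fun l _ => Finset.sum_comm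
    _ = ∑ l, ∑ k, ∑ i, ∑ j, X i j * star (Y k l) * R (j, k) (i, l) := by
        rw [Finset.sum_comm]
        exact Finset.sum_congr rfl fun l _ => Finset.sum_comm
    _ = ∑ k, ∑ l, ∑ i, ∑ j, X i j * star (Y k l) * R (j, k) (i, l) := Finset.sum_comm
    _ = _ := by simp only [mul_assoc, mul_left_comm]

lemma trace_kronecker_mul_swapFactors {R : Matrix (a × b) (a × b) ℂ} (hR : R.IsHermitian)
    (X : Matrix a a ℂ) (Y : Matrix b b ℂ) :
    ((X ⊗ₖ Yᴴ) * R).trace = star (∑ i, ∑ j, star (X i j) * slice (swapFactors R) Y i j) := by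
  rw [trace_kronecker_mul]
  have h : ∀ p q, star (R p q) = R q p := fun p q => hR.apply q p
  simp only [slice, Matrix.of_apply, star_sum, star_mul', star_star, Finset.mul_sum,
    Matrix.submatrix_apply, Prod.swap_prod_mk, h]
  calc _ = ∑ k, ∑ i, ∑ l, ∑ j, star (Y k l) * (X i j * R (j, k) (i, l)) :=
        Finset.sum_congr rfl fun k _ => Finset.sum_comm
    _ = ∑ i, ∑ k, ∑ j, ∑ l, star (Y k l) * (X i j * R (j, k) (i, l)) := by
        rw [Finset.sum_comm]
        exact Finset.sum_congr rfl fun l _ => Finset.sum_congr rfl fun k _ => Finset.sum_comm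
    _ = ∑ i, ∑ j, ∑ k, ∑ l, star (Y k l) * (X i j * R (j, k) (i, l)) :=
        Finset.sum_congr rfl fun k _ => Finset.sum_comm
    _ = _ := by simp only [mul_left_comm]

lemma posSemidef_scaledSlice [DecidableEq b] {R : Matrix (a × b) (a × b) ℂ} (hR : R.PosSemidef)
    {m : b → ℝ} (hm : ∀ k, 0 ≤ m k) {X : Matrix a a ℂ} (hX : X.PosSemidef) :
    (scaledSlice R m X).PosSemidef := by
  obtain ⟨C, rfl⟩ := exists_eq_conjTranspose_mul_self hX
  -- Kraus operators of the map, evaluated at `X = Cᴴ C`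
  let V : a → Matrix b (a × b) ℂ := fun r => Matrix.of fun k p =>
    if k = p.2 then ((√(m k))⁻¹ : ℝ) * C r p.1 else 0
  have : scaledSlice R m (Cᴴ * C) = ∑ r, V r * R * (V r)ᴴ := by
    ext k l
    simp only [scaledSlice_apply, slice, Matrix.of_apply, Matrix.sum_apply, Matrix.mul_apply, V,
      Matrix.conjTranspose_apply, Fintype.sum_prod_type, ite_mul, zero_mul, Finset.sum_ite_eq,
      Finset.mem_univ, if_true, apply_ite star, star_zero, mul_ite, mul_zero, star_mul',
      Finset.mul_sum, Finset.sum_mul, Real.sqrt_mul (hm k), mul_inv, Complex.ofReal_mul]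
    rw [Finset.sum_congr rfl fun i _ => Finset.sum_comm, Finset.sum_comm]
    refine Finset.sum_congr rfl fun r _ => Finset.sum_congr rfl fun i _ =>
      Finset.sum_congr rfl fun j _ => ?_
    simp only [RCLike.star_def, Complex.conj_ofReal]
    ring
  rw [this]
  exact Matrix.posSemidef_sum _ fun r _ => hR.mul_mul_conjTranspose_same _

lemma wInner_scaledSlice (R : Matrix (a × b) (a × b) ℂ) {m : b → ℝ} (hm : ∀ k, 0 < m k)
    (X : Matrix a a ℂ) (Y : Matrix b b ℂ) :
    wInner (fun k l => √(m k * m l)) Y (scaledSlice R m X) = ((X ⊗ₖ Yᴴ) * R).trace := by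
  rw [trace_kronecker_mul, wInner]
  refine Finset.sum_congr rfl fun k _ => Finset.sum_congr rfl fun l _ => ?_
  have h : ((√(m k * m l) : ℝ) : ℂ) ≠ 0 :=
    Complex.ofReal_ne_zero.2 (Real.sqrt_pos.2 (mul_pos (hm k) (hm l))).ne'
  rw [scaledSlice_apply, Complex.ofReal_inv]
  field_simp

lemma wInner_scaledSlice_swapFactors {R : Matrix (a × b) (a × b) ℂ} (hR : R.IsHermitian)
    {m : a → ℝ} (hm : ∀ k, 0 < m k) (X : Matrix a a ℂ) (Y : Matrix b b ℂ) :
    star (wInner (fun k l => √(m k * m l)) X (scaledSlice (swapFactors R) m Y))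
      = ((X ⊗ₖ Yᴴ) * R).trace := by
  rw [wInner_scaledSlice (swapFactors R) hm Y X, trace_kronecker_mul,
    trace_kronecker_mul_swapFactors hR]

end Slice

section GM

variable {a b : Type*} [Fintype a] [DecidableEq a] [Fintype b] [DecidableEq b]

/-- The unital positive map `T' T` preserves the faithful positive functional
`Z ↦ ∑ i, m i * Z i i`; this bounds the orbits of positive semidefinite matrices, which span. -/
lemma exists_wSq_orbit_le {m : a → ℝ} (hm : ∀ i, 0 < m i) (S : Matrix a a ℂ →ₗ[ℂ] Matrix a a ℂ)
    (hpos : ∀ Z : Matrix a a ℂ, Z.PosSemidef → (S Z).PosSemidef)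
    (hinv : ∀ Z, wInner (fun i j => √(m i * m j)) 1 (S Z) = wInner (fun i j => √(m i * m j)) 1 Z)
    (X : Matrix a a ℂ) : ∃ C : ℝ, ∀ r : ℕ, wSq (fun i j => √(m i * m j)) ((S ^ r) X) ≤ C := by
  have key : ∃ C : ℝ, ∀ (r : ℕ) (i j : a), ‖((S ^ r) X) i j‖ ≤ C := by
    have hX : X ∈ Submodule.span ℂ {X : Matrix a a ℂ | X.PosSemidef} := by
      rw [span_posSemidef]; trivial
    induction hX using Submodule.span_induction with
    | mem Z hZ =>
      have hp : ∀ r : ℕ, ((S ^ r) Z).PosSemidef := by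
        intro r
        induction r with
        | zero => simpa using hZ
        | succ r ih => rw [pow_succ', Module.End.mul_apply]; exact hpos _ ih
      have hi : ∀ r : ℕ, wInner (fun i j => √(m i * m j)) 1 ((S ^ r) Z)
          = wInner (fun i j => √(m i * m j)) 1 Z := by
        intro r
        induction r with
        | zero => simp
        | succ r ih => rw [pow_succ', Module.End.mul_apply, hinv, ih]
      have hform : ∀ Y : Matrix a a ℂ, (wInner (fun i j => √(m i * m j)) 1 Y).re
          = ∑ i, m i * (Y i i).re := by
        intro Y
        simp [wInner, Matrix.one_apply, Complex.re_sum, apply_ite, Real.sqrt_mul_self (hm _).le]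
      set c := ∑ i, m i * (Z i i).re
      have hdiag : ∀ (r : ℕ) (i : a), (((S ^ r) Z) i i).re ≤ ∑ i, c / m i := by
        intro r i
        have hnn : ∀ i, 0 ≤ (((S ^ r) Z) i i).re := fun i =>
          (Complex.nonneg_iff.1 ((hp r).diag_nonneg (i := i))).1
        have hc : ∑ i, m i * (((S ^ r) Z) i i).re = c := by rw [← hform, hi r, hform]
        have hc0 : 0 ≤ c := hc ▸ Finset.sum_nonneg fun i _ => mul_nonneg (hm i).le (hnn i)
        have h1 : m i * (((S ^ r) Z) i i).re ≤ c := by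
          rw [← hc]
          exact Finset.single_le_sum (f := fun i => m i * (((S ^ r) Z) i i).re)
            (fun i _ => mul_nonneg (hm i).le (hnn i)) (Finset.mem_univ i)
        refine le_trans ?_ (Finset.single_le_sum (f := fun i => c / m i)
          (fun i _ => div_nonneg hc0 (hm i).le) (Finset.mem_univ i))
        rw [le_div_iff₀ (hm i)]
        linarith
      exact ⟨_, fun r i j => (norm_entry_le (hp r) i j).trans (add_le_add (hdiag r i) (hdiag r j))⟩
    | zero => exact ⟨0, fun r i j => by simp⟩
    | add Y Z _ _ hY hZ =>
      obtain ⟨C, hC⟩ := hY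
      obtain ⟨D, hD⟩ := hZ
      refine ⟨C + D, fun r i j => ?_⟩
      rw [map_add, Matrix.add_apply]
      exact (norm_add_le _ _).trans (add_le_add (hC r i j) (hD r i j))
    | smul c Y _ hY =>
      obtain ⟨C, hC⟩ := hY
      refine ⟨‖c‖ * C, fun r i j => ?_⟩
      rw [map_smul, Matrix.smul_apply, norm_smul]
      exact mul_le_mul_of_nonneg_left (hC r i j) (norm_nonneg c)
  obtain ⟨C, hC⟩ := key
  refine ⟨∑ i, ∑ j, √(m i * m j) * C ^ 2, fun r => Finset.sum_le_sum fun i _ =>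
    Finset.sum_le_sum fun j _ => mul_le_mul_of_nonneg_left ?_ (Real.sqrt_nonneg _)⟩
  exact pow_le_pow_left₀ (norm_nonneg _) (hC r i j) 2

/-- The Cauchy–Schwarz inequality of the geometric mean for invertible diagonal marginals: it says
that the unital positive map `scaledSlice R q` is a contraction for the weighted forms. -/
lemma norm_trace_sq_le_of_pos {R : Matrix (a × b) (a × b) ℂ} (hR : R.PosSemidef) {p : a → ℝ}
    {q : b → ℝ} (hp : ∀ i, 0 < p i) (hq : ∀ k, 0 < q k)
    (hA : ∀ i j, ∑ k, R (i, k) (j, k) = if i = j then (p i : ℂ) else 0)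
    (hB : ∀ k l, ∑ i, R (i, k) (i, l) = if k = l then (q k : ℂ) else 0)
    (X : Matrix a a ℂ) (Y : Matrix b b ℂ) :
    ‖((X ⊗ₖ Yᴴ) * R).trace‖ ^ 2
      ≤ wSq (fun i j => √(p i * p j)) X * wSq (fun k l => √(q k * q l)) Y := by
  set T := scaledSlice R q
  set T' := scaledSlice (swapFactors R) p
  have hp0 : ∀ i j, 0 ≤ √(p i * p j) := fun i j => Real.sqrt_nonneg _
  have hq0 : ∀ i j, 0 ≤ √(q i * q j) := fun i j => Real.sqrt_nonneg _
  have hadj : ∀ X Y, wInner (fun k l => √(q k * q l)) Y (T X)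
      = star (wInner (fun i j => √(p i * p j)) X (T' Y)) := fun X Y => by
    rw [wInner_scaledSlice R hq, wInner_scaledSlice_swapFactors hR.isHermitian hp]
  have hT1 : T 1 = 1 := scaledSlice_one hq hB
  have hT'1 : T' 1 = 1 := scaledSlice_one hp hA
  have hinv : ∀ Z, wInner (fun i j => √(p i * p j)) 1 ((T' ∘ₗ T) Z)
      = wInner (fun i j => √(p i * p j)) 1 Z := by
    intro Z
    rw [LinearMap.comp_apply]
    have h1 := hadj 1 (T Z)
    have h2 := hadj Z 1
    rw [hT1] at h1
    rw [hT'1] at h2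
    rw [← star_star (wInner _ 1 (T' (T Z))), ← h1, star_wInner, h2, star_wInner]
  have hcontr := wSq_map_le hp0 hq0 T T' hadj X (exists_wSq_orbit_le hp (T' ∘ₗ T)
    (fun Z hZ => posSemidef_scaledSlice (hR.submatrix _) (fun i => (hp i).le)
      (posSemidef_scaledSlice hR (fun i => (hq i).le) hZ)) hinv X)
  rw [← wInner_scaledSlice R hq]
  calc _ ≤ _ := norm_wInner_sq_le hq0 Y (T X)
    _ ≤ _ := mul_le_mul_of_nonneg_left hcontr (wSq_nonneg hq0 Y)
    _ = _ := mul_comm _ _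

/-- The Cauchy–Schwarz inequality
`|Tr[(X ⊗ Y*) R]|² ≤ Tr[X* σ^{1/2} X σ^{1/2}] Tr[Y* τ^{1/2} Y τ^{1/2}]` for a positive semidefinite
`R` with diagonal marginals `σ = diag(p)` and `τ = diag(q)`. -/
lemma norm_trace_sq_le_of_diagonal [Nonempty a] [Nonempty b] {R : Matrix (a × b) (a × b) ℂ}
    (hR : R.PosSemidef) {p : a → ℝ} {q : b → ℝ} (hp : ∀ i, 0 ≤ p i) (hq : ∀ k, 0 ≤ q k)
    (hA : ∀ i j, ∑ k, R (i, k) (j, k) = if i = j then (p i : ℂ) else 0)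
    (hB : ∀ k l, ∑ i, R (i, k) (i, l) = if k = l then (q k : ℂ) else 0)
    (X : Matrix a a ℂ) (Y : Matrix b b ℂ) :
    ‖((X ⊗ₖ Yᴴ) * R).trace‖ ^ 2
      ≤ wSq (fun i j => √(p i * p j)) X * wSq (fun k l => √(q k * q l)) Y := by
  -- regularize: the marginals of `R + ε` are `p + ε |b| > 0` and `q + ε |a| > 0`
  set P : ℝ → a → ℝ := fun ε i => p i + ε * Fintype.card b with hP
  set Q : ℝ → b → ℝ := fun ε k => q k + ε * Fintype.card a with hQ
  have hcb : (0 : ℝ) < Fintype.card b := by exact_mod_cast Fintype.card_pos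
  have hca : (0 : ℝ) < Fintype.card a := by exact_mod_cast Fintype.card_pos
  have hε : ∀ ε : ℝ, 0 < ε →
      ‖((X ⊗ₖ Yᴴ) * R).trace + (ε : ℂ) * (X ⊗ₖ Yᴴ).trace‖ ^ 2
        ≤ wSq (fun i j => √(P ε i * P ε j)) X * wSq (fun k l => √(Q ε k * Q ε l)) Y := by
    intro ε hε
    have hR' : (R + (ε : ℂ) • (1 : Matrix (a × b) (a × b) ℂ)).PosSemidef :=
      hR.add (Matrix.PosSemidef.one.smul (Complex.zero_le_real.2 hε.le))
    have h := norm_trace_sq_le_of_pos hR' (p := P ε) (q := Q ε)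
      (fun i => add_pos_of_nonneg_of_pos (hp i) (mul_pos hε hcb))
      (fun k => add_pos_of_nonneg_of_pos (hq k) (mul_pos hε hca))
      (fun i j => by
        simp only [Matrix.add_apply, Finset.sum_add_distrib, hA, Matrix.smul_apply,
          Matrix.one_apply, Prod.mk.injEq, and_true]
        split_ifs <;> simp [hP, mul_comm])
      (fun k l => by
        simp only [Matrix.add_apply, Finset.sum_add_distrib, hB, Matrix.smul_apply,
          Matrix.one_apply, Prod.mk.injEq, true_and]
        split_ifs <;> simp [hQ, mul_comm]) X Y
    rwa [Matrix.mul_add, Matrix.trace_add, Matrix.mul_smul, Matrix.mul_one, Matrix.trace_smul,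
      smul_eq_mul] at h
  have hl : Tendsto (fun ε : ℝ => ‖((X ⊗ₖ Yᴴ) * R).trace + (ε : ℂ) * (X ⊗ₖ Yᴴ).trace‖ ^ 2)
      (𝓝[>] 0) (𝓝 (‖((X ⊗ₖ Yᴴ) * R).trace‖ ^ 2)) := by
    have : Continuous fun ε : ℝ =>
        ‖((X ⊗ₖ Yᴴ) * R).trace + (ε : ℂ) * (X ⊗ₖ Yᴴ).trace‖ ^ 2 := by fun_prop
    simpa using (this.tendsto 0).mono_left nhdsWithin_le_nhds
  have hr : Tendsto (fun ε : ℝ => wSq (fun i j => √(P ε i * P ε j)) X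
      * wSq (fun k l => √(Q ε k * Q ε l)) Y) (𝓝[>] 0)
      (𝓝 (wSq (fun i j => √(p i * p j)) X * wSq (fun k l => √(q k * q l)) Y)) := by
    have : Continuous fun ε : ℝ => wSq (fun i j => √(P ε i * P ε j)) X
        * wSq (fun k l => √(Q ε k * Q ε l)) Y := by
      unfold wSq; simp only [hP, hQ]; fun_prop
    simpa [hP, hQ] using (this.tendsto 0).mono_left nhdsWithin_le_nhds
  exact le_of_tendsto_of_tendsto hl hr
    (by filter_upwards [self_mem_nhdsWithin] with ε h using hε ε h)

end GM

/-! ### The eigenbasis of a state -/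

section Eigenbasis

variable {n : Type*} [Fintype n] [DecidableEq n] (σ : State n)

/-- The unitary matrix whose columns are the eigenvectors of a state. -/
noncomputable def State.basisChange : Matrix n n ℂ :=
  σ.posSemidef.isHermitian.eigenvectorUnitary

/-- The matrix of an operator in the eigenbasis of a state. -/
noncomputable def State.hat (X : Matrix n n ℂ) : Matrix n n ℂ :=
  σ.basisChangeᴴ * X * σ.basisChange

/-- The operator with a given matrix in the eigenbasis of a state. -/
noncomputable def State.unhat (Z : Matrix n n ℂ) : Matrix n n ℂ :=
  σ.basisChange * Z * σ.basisChangeᴴ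

lemma State.conjTranspose_mul_basisChange : σ.basisChangeᴴ * σ.basisChange = 1 :=
  Matrix.mem_unitaryGroup_iff'.1 σ.posSemidef.isHermitian.eigenvectorUnitary.2

lemma State.basisChange_mul_conjTranspose : σ.basisChange * σ.basisChangeᴴ = 1 :=
  Matrix.mem_unitaryGroup_iff.1 σ.posSemidef.isHermitian.eigenvectorUnitary.2

lemma State.hat_unhat (Z : Matrix n n ℂ) : σ.hat (σ.unhat Z) = Z := by
  calc σ.hat (σ.unhat Z)
      = (σ.basisChangeᴴ * σ.basisChange) * Z * (σ.basisChangeᴴ * σ.basisChange) := by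
        simp only [State.hat, State.unhat, Matrix.mul_assoc]
    _ = Z := by rw [σ.conjTranspose_mul_basisChange, Matrix.one_mul, Matrix.mul_one]

lemma State.unhat_hat (X : Matrix n n ℂ) : σ.unhat (σ.hat X) = X := by
  calc σ.unhat (σ.hat X)
      = (σ.basisChange * σ.basisChangeᴴ) * X * (σ.basisChange * σ.basisChangeᴴ) := by
        simp only [State.hat, State.unhat, Matrix.mul_assoc]
    _ = X := by rw [σ.basisChange_mul_conjTranspose, Matrix.one_mul, Matrix.mul_one]

lemma State.hat_mul (X Y : Matrix n n ℂ) : σ.hat (X * Y) = σ.hat X * σ.hat Y := by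
  calc σ.hat (X * Y) = σ.basisChangeᴴ * X * 1 * Y * σ.basisChange := by
        simp only [State.hat, Matrix.mul_assoc, Matrix.one_mul]
    _ = _ := by
        rw [← σ.basisChange_mul_conjTranspose]
        simp only [State.hat, Matrix.mul_assoc]

lemma State.hat_conjTranspose (X : Matrix n n ℂ) : σ.hat Xᴴ = (σ.hat X)ᴴ := by
  simp only [State.hat, Matrix.conjTranspose_mul, Matrix.conjTranspose_conjTranspose,
    Matrix.mul_assoc]

lemma State.unhat_conjTranspose (X : Matrix n n ℂ) : σ.unhat Xᴴ = (σ.unhat X)ᴴ := by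
  simp only [State.unhat, Matrix.conjTranspose_mul, Matrix.conjTranspose_conjTranspose,
    Matrix.mul_assoc]

lemma State.hat_smul (c : ℂ) (X : Matrix n n ℂ) : σ.hat (c • X) = c • σ.hat X := by
  simp only [State.hat, Matrix.mul_smul, Matrix.smul_mul]

lemma State.trace_hat (X : Matrix n n ℂ) : (σ.hat X).trace = X.trace := by
  rw [State.hat, Matrix.trace_mul_comm, ← Matrix.mul_assoc, σ.basisChange_mul_conjTranspose,
    Matrix.one_mul]

lemma State.hat_mat : σ.hat σ.mat = Matrix.diagonal fun i => (σ.eigval i : ℂ) := by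
  have h := σ.posSemidef.isHermitian.conjStarAlgAut_star_eigenvectorUnitary
  rw [Unitary.conjStarAlgAut_star_apply] at h
  exact h

lemma State.eigval_nonneg (i : n) : 0 ≤ σ.eigval i := σ.posSemidef.eigenvalues_nonneg i

lemma State.eigproj_eq (i : n) :
    σ.eigproj i = σ.basisChange * Matrix.single i i 1 * σ.basisChangeᴴ := by
  ext k l
  rw [Matrix.mul_apply, Finset.sum_eq_single i]
  · rw [Matrix.mul_apply, Finset.sum_eq_single i]
    · rw [Matrix.single_apply_same, mul_one]; rfl
    · intro j _ hj
      rw [Matrix.single_apply_of_row_ne hj.symm, mul_zero]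
    · simp
  · intro j _ hj
    rw [Matrix.mul_apply, Finset.sum_eq_zero, zero_mul]
    intro m _
    rw [Matrix.single_apply_of_col_ne _ _ hj.symm, mul_zero]
  · simp

lemma J_eq (f : ℝ → ℝ) (X : Matrix n n ℂ) :
    J f σ X = σ.unhat (Matrix.of fun i j =>
      (perspective f (σ.eigval i) (σ.eigval j) : ℂ) * σ.hat X i j) := by
  have h : ∀ i j, σ.eigproj i * X * σ.eigproj j
      = σ.unhat (Matrix.single i j (σ.hat X i j)) := by
    intro i j
    have : Matrix.single i j (σ.hat X i j)
        = Matrix.single i i 1 * σ.hat X * Matrix.single j j 1 := by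
      rw [Matrix.single_mul_mul_single, one_mul, mul_one]
    rw [this, σ.eigproj_eq, σ.eigproj_eq]
    simp only [State.hat, State.unhat, Matrix.mul_assoc]
  have h2 : (Matrix.of fun i j =>
      (perspective f (σ.eigval i) (σ.eigval j) : ℂ) * σ.hat X i j)
      = ∑ i, ∑ j, ((perspective f (σ.eigval i) (σ.eigval j) : ℝ) : ℂ) •
        Matrix.single i j (σ.hat X i j) := by
    conv_lhs => rw [Matrix.matrix_eq_sum_single (Matrix.of _)]
    simp only [Matrix.of_apply, Matrix.smul_single, smul_eq_mul]
  rw [h2]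
  simp only [J, h, State.unhat, Finset.mul_sum, Finset.sum_mul, Matrix.mul_smul, Matrix.smul_mul]

lemma innerF_eq_wInner (f : ℝ → ℝ) (X Y : Matrix n n ℂ) :
    innerF f σ X Y
      = wInner (fun i j => perspective f (σ.eigval i) (σ.eigval j)) (σ.hat X) (σ.hat Y) := by
  rw [innerF, J_eq, ← σ.trace_hat, σ.hat_mul, σ.hat_unhat, σ.hat_conjTranspose, wInner,
    Finset.sum_comm]
  simp only [Matrix.trace, Matrix.diag_apply, Matrix.mul_apply, Matrix.conjTranspose_apply,
    Matrix.of_apply]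
  exact Finset.sum_congr rfl fun i _ => Finset.sum_congr rfl fun j _ => by ring

lemma innerF_self (f : ℝ → ℝ) (X : Matrix n n ℂ) :
    innerF f σ X X
      = (wSq (fun i j => perspective f (σ.eigval i) (σ.eigval j)) (σ.hat X) : ℂ) := by
  rw [innerF_eq_wInner, wInner_self]

lemma innerF_one {f : ℝ → ℝ} (hf : f 1 = 1) (X : Matrix n n ℂ) :
    innerF f σ 1 X = (σ.mat * X).trace := by
  have h1 : σ.hat 1 = 1 := by
    rw [State.hat, Matrix.mul_one, σ.conjTranspose_mul_basisChange]
  rw [innerF_eq_wInner, h1, ← σ.trace_hat (σ.mat * X), σ.hat_mul, σ.hat_mat]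
  simp [wInner, Matrix.one_apply, Matrix.trace, perspective_self hf, apply_ite]

/-- For Hermitian operators the variance of the arithmetic mean is `Tr[σ X²]`. -/
lemma innerF_fAM {X : Matrix n n ℂ} (hX : X.IsHermitian) :
    innerF fAM σ X X = (σ.mat * (X * X)).trace := by
  have hh : ∀ i j, star (σ.hat X i j) = σ.hat X j i := by
    intro i j
    rw [← Matrix.conjTranspose_apply, ← σ.hat_conjTranspose, hX.eq]
  have e : (σ.mat * (X * X)).trace
      = ∑ i, ∑ j, (σ.eigval i : ℂ) * (σ.hat X i j * σ.hat X j i) := by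
    rw [← σ.trace_hat, σ.hat_mul, σ.hat_mat, σ.hat_mul]
    simp only [Matrix.trace, Matrix.diag_apply, Matrix.diagonal_mul]
    simp only [Matrix.mul_apply, Finset.mul_sum]
  have e' : (σ.mat * (X * X)).trace
      = ∑ i, ∑ j, (σ.eigval j : ℂ) * (σ.hat X i j * σ.hat X j i) := by
    rw [e, Finset.sum_comm]
    exact Finset.sum_congr rfl fun i _ => Finset.sum_congr rfl fun j _ => by ring
  have e2 : innerF fAM σ X X = ((σ.mat * (X * X)).trace + (σ.mat * (X * X)).trace) / 2 := by
    conv_rhs => rw [e']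
    nth_rewrite 2 [← e']
    rw [e, innerF_eq_wInner, wInner, ← Finset.sum_add_distrib, Finset.sum_div]
    refine Finset.sum_congr rfl fun i _ => ?_
    rw [← Finset.sum_add_distrib, Finset.sum_div]
    refine Finset.sum_congr rfl fun j _ => ?_
    rw [hh, perspective_fAM]
    push_cast
    ring
  rw [e2, add_self_div_two]

/-- A positive weight on the support of `σ` controls the weight of the geometric mean. -/
lemma exists_wSq_sqrt_le {w : n → n → ℝ} (hw : ∀ i j, 0 ≤ w i j)
    (hpos : ∀ i j, 0 < σ.eigval i → 0 < σ.eigval j → 0 < w i j) :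
    ∃ C : ℝ, 0 ≤ C ∧ ∀ Z : Matrix n n ℂ,
      wSq (fun i j => √(σ.eigval i * σ.eigval j)) Z ≤ C * wSq w Z := by
  have hnn : ∀ i j, 0 ≤ √(σ.eigval i * σ.eigval j) / w i j := fun i j =>
    div_nonneg (Real.sqrt_nonneg _) (hw i j)
  refine ⟨∑ i, ∑ j, √(σ.eigval i * σ.eigval j) / w i j,
    Finset.sum_nonneg fun i _ => Finset.sum_nonneg fun j _ => hnn i j, fun Z => ?_⟩
  rw [← wSq_const_mul]
  refine wSq_mono (fun i j => ?_) Z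
  have h1 : √(σ.eigval i * σ.eigval j) / w i j
      ≤ ∑ i, ∑ j, √(σ.eigval i * σ.eigval j) / w i j :=
    (Finset.single_le_sum (f := fun j => √(σ.eigval i * σ.eigval j) / w i j)
      (fun j _ => hnn i j) (Finset.mem_univ j)).trans
      (Finset.single_le_sum (f := fun i => ∑ j, √(σ.eigval i * σ.eigval j) / w i j)
        (fun i _ => Finset.sum_nonneg fun j _ => hnn i j) (Finset.mem_univ i))
  refine le_trans ?_ (mul_le_mul_of_nonneg_right h1 (hw i j))
  rcases (σ.eigval_nonneg i).eq_or_lt with hi | hi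
  · simp [← hi]
  rcases (σ.eigval_nonneg j).eq_or_lt with hj | hj
  · simp [← hj]
  rw [div_mul_cancel₀ _ (hpos i j hi hj).ne']

end Eigenbasis

section Bipartite

variable {a b : Type*} [Fintype a] [Fintype b]

lemma State.nonempty {n : Type*} [Fintype n] (σ : State n) : Nonempty n := by
  by_contra h
  rw [not_nonempty_iff] at h
  have := σ.trace_one
  simp [Matrix.trace] at this

variable (ρ : State (a × b))

lemma trace_kronecker_one_mul [DecidableEq b] (X : Matrix a a ℂ) :
    ((X ⊗ₖ (1 : Matrix b b ℂ)) * ρ.mat).trace = (X * ρ.margA.mat).trace := by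
  simp only [Matrix.trace, Matrix.diag_apply, Matrix.mul_apply, Fintype.sum_prod_type,
    Matrix.kronecker_apply, Matrix.one_apply, mul_ite, mul_one, mul_zero, ite_mul, zero_mul,
    Finset.sum_ite_eq, Finset.mem_univ, if_true, State.margA, Matrix.sum_apply,
    Matrix.submatrix_apply, Finset.mul_sum]

lemma trace_one_kronecker_mul [DecidableEq a] (Y : Matrix b b ℂ) :
    (((1 : Matrix a a ℂ) ⊗ₖ Y) * ρ.mat).trace = (Y * ρ.margB.mat).trace := by
  simp only [Matrix.trace, Matrix.diag_apply, Matrix.mul_apply, Fintype.sum_prod_type_right,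
    Matrix.kronecker_apply, Matrix.one_apply, ite_mul, one_mul, zero_mul,
    Finset.sum_ite_eq, Finset.mem_univ, if_true, State.margB, Matrix.sum_apply,
    Matrix.submatrix_apply, Finset.mul_sum]

variable [DecidableEq a] [DecidableEq b]

/-- The state in the product of the eigenbases of its marginals. -/
noncomputable def State.rotated : Matrix (a × b) (a × b) ℂ :=
  (ρ.margA.basisChange ⊗ₖ ρ.margB.basisChange)ᴴ * ρ.mat *
    (ρ.margA.basisChange ⊗ₖ ρ.margB.basisChange)

lemma trace_kronecker_mul_rotated (X : Matrix a a ℂ) (Y : Matrix b b ℂ) :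
    ((X ⊗ₖ Y) * ρ.rotated).trace = ((ρ.margA.unhat X ⊗ₖ ρ.margB.unhat Y) * ρ.mat).trace := by
  rw [State.rotated, State.unhat, State.unhat, Matrix.mul_kronecker_mul, Matrix.mul_kronecker_mul,
    ← Matrix.mul_assoc, ← Matrix.mul_assoc, Matrix.trace_mul_comm, Matrix.conjTranspose_kronecker]
  simp only [Matrix.mul_assoc]

lemma rotated_margA (i j : a) : ∑ k, ρ.rotated (i, k) (j, k)
    = if i = j then (ρ.margA.eigval i : ℂ) else 0 := by
  have h1 : ∑ k, ρ.rotated (i, k) (j, k)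
      = ((Matrix.single j i (1 : ℂ) ⊗ₖ (1 : Matrix b b ℂ)) * ρ.rotated).trace := by
    simp [Matrix.trace, Matrix.mul_apply, Fintype.sum_prod_type, Matrix.single_apply,
      Matrix.one_apply, ite_and]
  have h2 : ρ.margB.unhat 1 = 1 := by
    rw [State.unhat, Matrix.mul_one, State.basisChange_mul_conjTranspose]
  rw [h1, trace_kronecker_mul_rotated, h2, trace_kronecker_one_mul, ← ρ.margA.trace_hat,
    State.hat_mul, State.hat_unhat, State.hat_mat, Matrix.trace_single_mul, one_smul,
    Matrix.diagonal_apply]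

lemma rotated_margB (k l : b) : ∑ i, ρ.rotated (i, k) (i, l)
    = if k = l then (ρ.margB.eigval k : ℂ) else 0 := by
  have h1 : ∑ i, ρ.rotated (i, k) (i, l)
      = (((1 : Matrix a a ℂ) ⊗ₖ Matrix.single l k (1 : ℂ)) * ρ.rotated).trace := by
    simp [Matrix.trace, Matrix.mul_apply, Fintype.sum_prod_type_right, Matrix.single_apply,
      Matrix.one_apply, ite_and]
  have h2 : ρ.margA.unhat 1 = 1 := by
    rw [State.unhat, Matrix.mul_one, State.basisChange_mul_conjTranspose]
  rw [h1, trace_kronecker_mul_rotated, h2, trace_one_kronecker_mul, ← ρ.margB.trace_hat,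
    State.hat_mul, State.hat_unhat, State.hat_mat, Matrix.trace_single_mul, one_smul,
    Matrix.diagonal_apply]

/-- The Cauchy–Schwarz inequality of the geometric mean, for a general state. -/
lemma objective_sq_le (X : Matrix a a ℂ) (Y : Matrix b b ℂ) :
    objective ρ X Y ^ 2
      ≤ wSq (fun i j => √(ρ.margA.eigval i * ρ.margA.eigval j)) (ρ.margA.hat X)
        * wSq (fun k l => √(ρ.margB.eigval k * ρ.margB.eigval l)) (ρ.margB.hat Y) := by
  have := ρ.margA.nonempty
  have := ρ.margB.nonempty
  have h := norm_trace_sq_le_of_diagonal (ρ.posSemidef.conjTranspose_mul_mul_same _)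
    ρ.margA.eigval_nonneg ρ.margB.eigval_nonneg (rotated_margA ρ) (rotated_margB ρ)
    (ρ.margA.hat X) (ρ.margB.hat Y)
  change ‖((_ ⊗ₖ _) * ρ.rotated).trace‖ ^ 2 ≤ _ at h
  rwa [trace_kronecker_mul_rotated, State.unhat_hat, ← State.hat_conjTranspose,
    State.unhat_hat] at h

end Bipartite

/-! ### Faithfulness and the bound by one -/

section Variance

lemma isHermitian_ofReal_smul {n : Type*} (c : ℝ) {Z : Matrix n n ℂ} (hZ : Z.IsHermitian) :
    ((c : ℂ) • Z).IsHermitian := by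
  rw [Matrix.IsHermitian, Matrix.conjTranspose_smul, hZ.eq, RCLike.star_def, Complex.conj_ofReal]

variable {n : Type*} [Fintype n]

lemma star_trace_mul (σ : State n) {X : Matrix n n ℂ} (hX : X.IsHermitian) :
    star (σ.mat * X).trace = (σ.mat * X).trace := by
  rw [← Matrix.trace_conjTranspose, Matrix.conjTranspose_mul, hX.eq,
    σ.posSemidef.isHermitian.eq, Matrix.trace_mul_comm]

variable [DecidableEq n]

/-- The variance `⟨X, X⟩_{f,σ}` as a real number. -/
noncomputable def variance (f : ℝ → ℝ) (σ : State n)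
    (X : Matrix n n ℂ) : ℝ :=
  wSq (fun i j => perspective f (σ.eigval i) (σ.eigval j)) (σ.hat X)

lemma innerF_self_eq_variance (f : ℝ → ℝ) (σ : State n)
    (X : Matrix n n ℂ) : innerF f σ X X = (variance f σ X : ℂ) := innerF_self σ f X

lemma variance_smul (f : ℝ → ℝ) (σ : State n) (c : ℝ)
    (X : Matrix n n ℂ) : variance f σ ((c : ℂ) • X) = c ^ 2 * variance f σ X := by
  simp only [variance, State.hat_smul, wSq, Matrix.smul_apply, norm_smul, Complex.norm_real,
    mul_pow, Real.norm_eq_abs, sq_abs, Finset.mul_sum, mul_left_comm]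

lemma IsNormalizedOperatorMonotone.variance_nonneg {f : ℝ → ℝ}
    (hf : IsNormalizedOperatorMonotone f) (σ : State n) (Z : Matrix n n ℂ) :
    0 ≤ variance f σ Z :=
  wSq_nonneg (fun i j => hf.perspective_nonneg (σ.eigval_nonneg i) (σ.eigval_nonneg j)) _

end Variance

section Objective

variable {a b : Type*} [Fintype a] [Fintype b]

lemma objective_nonneg (ρ : State (a × b)) (X : Matrix a a ℂ) (Y : Matrix b b ℂ) :
    0 ≤ objective ρ X Y := norm_nonneg _

lemma objective_smul (ρ : State (a × b)) {s t : ℝ} (hs : 0 ≤ s) (ht : 0 ≤ t) (X : Matrix a a ℂ)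
    (Y : Matrix b b ℂ) : objective ρ ((s : ℂ) • X) ((t : ℂ) • Y) = s * t * objective ρ X Y := by
  rw [objective, Matrix.conjTranspose_smul, Matrix.smul_kronecker, Matrix.kronecker_smul,
    Matrix.smul_mul, Matrix.smul_mul, Matrix.trace_smul, Matrix.trace_smul, norm_smul, norm_smul,
    norm_star, Complex.norm_real, Complex.norm_real, Real.norm_of_nonneg hs,
    Real.norm_of_nonneg ht, objective, mul_assoc]

end Objective

section Bounds

variable {a b : Type*} [Fintype a] [DecidableEq a] [Fintype b] [DecidableEq b]
  {f : ℝ → ℝ} {ρ : State (a × b)}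

lemma valuesHerm_subset (f : ℝ → ℝ) (ρ : State (a × b)) : valuesHerm f ρ ⊆ valuesLin f ρ :=
  fun _ ⟨X, Y, _, _, h, e⟩ => ⟨X, Y, h, e⟩

/-- The objective is controlled by the variances: only the compressions of `X` and `Y` to the
supports of the marginals enter. -/
lemma exists_objective_sq_le (hf : IsNormalizedOperatorMonotone f) (ρ : State (a × b)) :
    ∃ C : ℝ, 0 ≤ C ∧ ∀ X Y,
      objective ρ X Y ^ 2 ≤ C * (variance f ρ.margA X * variance f ρ.margB Y) := by
  obtain ⟨C, hC0, hC⟩ := exists_wSq_sqrt_le ρ.margA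
    (w := fun i j => perspective f (ρ.margA.eigval i) (ρ.margA.eigval j))
    (fun i j => hf.perspective_nonneg (ρ.margA.eigval_nonneg i) (ρ.margA.eigval_nonneg j))
    (fun i j => hf.perspective_pos)
  obtain ⟨D, hD0, hD⟩ := exists_wSq_sqrt_le ρ.margB
    (w := fun i j => perspective f (ρ.margB.eigval i) (ρ.margB.eigval j))
    (fun i j => hf.perspective_nonneg (ρ.margB.eigval_nonneg i) (ρ.margB.eigval_nonneg j))
    (fun i j => hf.perspective_pos)
  refine ⟨C * D, mul_nonneg hC0 hD0, fun X Y => (objective_sq_le ρ X Y).trans ?_⟩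
  have h1 := hC (ρ.margA.hat X)
  have h2 := hD (ρ.margB.hat Y)
  have h0 := wSq_nonneg (fun k l => Real.sqrt_nonneg (ρ.margB.eigval k * ρ.margB.eigval l))
    (ρ.margB.hat Y)
  calc _ ≤ (C * variance f ρ.margA X) * (D * variance f ρ.margB Y) :=
        mul_le_mul h1 h2 h0 ((wSq_nonneg (fun k l => Real.sqrt_nonneg _) _).trans h1)
    _ = _ := by ring

lemma Feasible.variance_left {X : Matrix a a ℂ} {Y : Matrix b b ℂ} (h : Feasible f ρ X Y) :
    variance f ρ.margA X = 1 := by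
  have := h.var_left
  rw [innerF_self_eq_variance] at this
  exact_mod_cast this

lemma Feasible.variance_right {X : Matrix a a ℂ} {Y : Matrix b b ℂ} (h : Feasible f ρ X Y) :
    variance f ρ.margB Y = 1 := by
  have := h.var_right
  rw [innerF_self_eq_variance] at this
  exact_mod_cast this

lemma bddAbove_valuesLin (hf : IsNormalizedOperatorMonotone f) (ρ : State (a × b)) :
    BddAbove (valuesLin f ρ) := by
  obtain ⟨C, -, hC⟩ := exists_objective_sq_le hf ρ
  refine ⟨√C, ?_⟩
  rintro _ ⟨X, Y, h, rfl⟩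
  have := hC X Y
  rw [h.variance_left, h.variance_right, mul_one, mul_one] at this
  exact Real.le_sqrt_of_sq_le this

lemma bddAbove_valuesHerm (hf : IsNormalizedOperatorMonotone f) (ρ : State (a × b)) :
    BddAbove (valuesHerm f ρ) := (bddAbove_valuesLin hf ρ).mono (valuesHerm_subset f ρ)

lemma mu_nonneg (f : ℝ → ℝ) (ρ : State (a × b)) : 0 ≤ mu f ρ :=
  Real.sSup_nonneg (by rintro _ ⟨X, Y, -, -, -, rfl⟩; exact objective_nonneg ρ X Y)

lemma muLin_nonneg (f : ℝ → ℝ) (ρ : State (a × b)) : 0 ≤ muLin f ρ :=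
  Real.sSup_nonneg (by rintro _ ⟨X, Y, -, rfl⟩; exact objective_nonneg ρ X Y)

lemma mu_le_muLin (hf : IsNormalizedOperatorMonotone f) (ρ : State (a × b)) :
    mu f ρ ≤ muLin f ρ := by
  refine Real.sSup_le (fun r hr => ?_) (muLin_nonneg f ρ)
  exact le_csSup (bddAbove_valuesLin hf ρ) (valuesHerm_subset f ρ hr)

lemma objective_sq_le_mul_variance
    (hgm : ∀ x y : ℝ, 0 ≤ x → 0 ≤ y → √(x * y) ≤ perspective f x y)
    (ρ : State (a × b)) (X : Matrix a a ℂ) (Y : Matrix b b ℂ) :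
    objective ρ X Y ^ 2 ≤ variance f ρ.margA X * variance f ρ.margB Y := by
  have h1 : wSq (fun i j => √(ρ.margA.eigval i * ρ.margA.eigval j)) (ρ.margA.hat X)
      ≤ variance f ρ.margA X :=
    wSq_mono (fun i j => hgm _ _ (ρ.margA.eigval_nonneg i) (ρ.margA.eigval_nonneg j)) _
  have h2 : wSq (fun i j => √(ρ.margB.eigval i * ρ.margB.eigval j)) (ρ.margB.hat Y)
      ≤ variance f ρ.margB Y :=
    wSq_mono (fun i j => hgm _ _ (ρ.margB.eigval_nonneg i) (ρ.margB.eigval_nonneg j)) _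
  exact (objective_sq_le ρ X Y).trans (mul_le_mul h1 h2
    (wSq_nonneg (fun k l => Real.sqrt_nonneg _) _)
    ((wSq_nonneg (fun k l => Real.sqrt_nonneg _) _).trans h1))

lemma Feasible.objective_le_one
    (hgm : ∀ x y : ℝ, 0 ≤ x → 0 ≤ y → √(x * y) ≤ perspective f x y)
    {X : Matrix a a ℂ} {Y : Matrix b b ℂ} (h : Feasible f ρ X Y) : objective ρ X Y ≤ 1 := by
  have := objective_sq_le_mul_variance hgm ρ X Y
  rw [h.variance_left, h.variance_right, mul_one] at this
  exact (pow_le_one_iff_of_nonneg (objective_nonneg ρ X Y) two_ne_zero).1 this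

lemma muLin_le_one (hgm : ∀ x y : ℝ, 0 ≤ x → 0 ≤ y → √(x * y) ≤ perspective f x y) :
    muLin f ρ ≤ 1 :=
  Real.sSup_le (by
    rintro _ ⟨X, Y, h, rfl⟩
    exact h.objective_le_one hgm) zero_le_one

/-- On a product state centered operators are uncorrelated. -/
lemma muLin_eq_zero_of_product (hf : f 1 = 1)
    (hρ : ρ.mat = ρ.margA.mat ⊗ₖ ρ.margB.mat) : muLin f ρ = 0 := by
  refine le_antisymm (Real.sSup_nonpos ?_) (muLin_nonneg f ρ)
  rintro _ ⟨X, Y, h, rfl⟩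
  have hX := h.mean_left
  rw [innerF_one _ hf, Matrix.trace_mul_comm] at hX
  rw [objective, hρ, ← Matrix.mul_kronecker_mul, Matrix.trace_kronecker, hX, zero_mul, norm_zero]

/-- If all centered Hermitian operators are uncorrelated, then the state is a product. -/
lemma product_of_uncorrelated
    (h : ∀ (X : Matrix a a ℂ) (Y : Matrix b b ℂ), X.IsHermitian → Y.IsHermitian →
      (ρ.margA.mat * X).trace = 0 → (ρ.margB.mat * Y).trace = 0 →
      ((X ⊗ₖ Y) * ρ.mat).trace = 0) :
    ρ.mat = ρ.margA.mat ⊗ₖ ρ.margB.mat := by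
  have herm : ∀ (X : Matrix a a ℂ) (Y : Matrix b b ℂ), X.IsHermitian → Y.IsHermitian →
      ((X ⊗ₖ Y) * ρ.mat).trace = ((X ⊗ₖ Y) * (ρ.margA.mat ⊗ₖ ρ.margB.mat)).trace := by
    intro X Y hX hY
    set x := (ρ.margA.mat * X).trace with hx
    set y := (ρ.margB.mat * Y).trace with hy
    have hcX : (X - x • 1).IsHermitian := by
      rw [Matrix.IsHermitian, Matrix.conjTranspose_sub, Matrix.conjTranspose_smul, hX.eq,
        Matrix.conjTranspose_one, star_trace_mul _ hX]
    have hcY : (Y - y • 1).IsHermitian := by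
      rw [Matrix.IsHermitian, Matrix.conjTranspose_sub, Matrix.conjTranspose_smul, hY.eq,
        Matrix.conjTranspose_one, star_trace_mul _ hY]
    have h0 := h _ _ hcX hcY
      (by rw [Matrix.mul_sub, Matrix.mul_smul, Matrix.mul_one, Matrix.trace_sub,
            Matrix.trace_smul, ρ.margA.trace_one, ← hx]; simp)
      (by rw [Matrix.mul_sub, Matrix.mul_smul, Matrix.mul_one, Matrix.trace_sub,
            Matrix.trace_smul, ρ.margB.trace_one, ← hy]; simp)
    have hexp : (X - x • 1) ⊗ₖ (Y - y • 1)
        = X ⊗ₖ Y - y • (X ⊗ₖ (1 : Matrix b b ℂ)) - x • ((1 : Matrix a a ℂ) ⊗ₖ (Y - y • 1)) := by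
      ext ⟨i, k⟩ ⟨j, l⟩
      simp only [Matrix.kronecker_apply, Matrix.sub_apply, Matrix.smul_apply, smul_eq_mul]
      ring
    rw [hexp, Matrix.sub_mul, Matrix.sub_mul, Matrix.smul_mul, Matrix.smul_mul, Matrix.trace_sub,
      Matrix.trace_sub, Matrix.trace_smul, Matrix.trace_smul, trace_kronecker_one_mul,
      trace_one_kronecker_mul, Matrix.sub_mul, Matrix.smul_mul, Matrix.one_mul, Matrix.trace_sub,
      Matrix.trace_smul, ρ.margB.trace_one, Matrix.trace_mul_comm X, Matrix.trace_mul_comm Y,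
      ← hx, ← hy] at h0
    rw [← Matrix.mul_kronecker_mul, Matrix.trace_kronecker, Matrix.trace_mul_comm X,
      Matrix.trace_mul_comm Y, ← hx, ← hy]
    simp only [smul_eq_mul, mul_one, sub_self, mul_zero, sub_zero] at h0
    linear_combination h0
  set R := ρ.mat - ρ.margA.mat ⊗ₖ ρ.margB.mat with hR
  have herm' : ∀ (X : Matrix a a ℂ) (Y : Matrix b b ℂ), X.IsHermitian → Y.IsHermitian →
      ((X ⊗ₖ Y) * R).trace = 0 := fun X Y hX hY => by
    rw [hR, Matrix.mul_sub, Matrix.trace_sub, herm X Y hX hY, sub_self]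
  -- extend from Hermitian operators to all operators by bilinearity
  have hall : ∀ (X : Matrix a a ℂ) (Y : Matrix b b ℂ), ((X ⊗ₖ Y) * R).trace = 0 := by
    intro X Y
    have hY : ∀ X : Matrix a a ℂ, X.IsHermitian → ((X ⊗ₖ Y) * R).trace = 0 := by
      intro X hX
      rw [← realPart_add_I_smul_imaginaryPart Y, Matrix.kronecker_add, Matrix.kronecker_smul,
        Matrix.add_mul, Matrix.smul_mul, Matrix.trace_add, Matrix.trace_smul,
        herm' X _ hX (realPart Y).2, herm' X _ hX (imaginaryPart Y).2, smul_zero, add_zero]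
    rw [← realPart_add_I_smul_imaginaryPart X, Matrix.add_kronecker, Matrix.smul_kronecker,
      Matrix.add_mul, Matrix.smul_mul, Matrix.trace_add, Matrix.trace_smul,
      hY _ (realPart X).2, hY _ (imaginaryPart X).2, smul_zero, add_zero]
  have hzero : R = 0 := by
    ext ⟨i, k⟩ ⟨j, l⟩
    have := hall (Matrix.single j i 1) (Matrix.single l k 1)
    rwa [Matrix.single_kronecker_single, Matrix.trace_single_mul, one_mul, one_smul] at this
  exact sub_eq_zero.1 hzero

lemma product_of_mu_eq_zero (hf : IsNormalizedOperatorMonotone f) (h : mu f ρ = 0) :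
    ρ.mat = ρ.margA.mat ⊗ₖ ρ.margB.mat := by
  refine product_of_uncorrelated fun X Y hX hY hmX hmY => ?_
  suffices hobj : objective ρ X Y = 0 by
    rw [objective, hY.eq, norm_eq_zero] at hobj
    exact hobj
  obtain ⟨C, -, hC⟩ := exists_objective_sq_le hf ρ
  have hXY := hC X Y
  rcases (hf.variance_nonneg ρ.margA X).eq_or_lt with h0 | hx
  · rw [← h0, zero_mul, mul_zero] at hXY
    exact pow_eq_zero_iff two_ne_zero |>.1 (le_antisymm hXY (sq_nonneg _))
  rcases (hf.variance_nonneg ρ.margB Y).eq_or_lt with h0 | hy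
  · rw [← h0, mul_zero, mul_zero] at hXY
    exact pow_eq_zero_iff two_ne_zero |>.1 (le_antisymm hXY (sq_nonneg _))
  -- normalize the variances
  set s : ℝ := (√(variance f ρ.margA X))⁻¹ with hs
  set t : ℝ := (√(variance f ρ.margB Y))⁻¹ with ht
  have hs0 : 0 < s := inv_pos.2 (Real.sqrt_pos.2 hx)
  have ht0 : 0 < t := inv_pos.2 (Real.sqrt_pos.2 hy)
  have hmem : objective ρ ((s : ℂ) • X) ((t : ℂ) • Y) ∈ valuesHerm f ρ := by
    refine ⟨_, _, isHermitian_ofReal_smul s hX, isHermitian_ofReal_smul t hY, ⟨?_, ?_, ?_, ?_⟩, rfl⟩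
    · rw [innerF_one _ hf.normalized, Matrix.mul_smul, Matrix.trace_smul, hmX, smul_zero]
    · rw [innerF_one _ hf.normalized, Matrix.mul_smul, Matrix.trace_smul, hmY, smul_zero]
    · rw [innerF_self_eq_variance, variance_smul, hs, inv_pow, Real.sq_sqrt hx.le,
        inv_mul_cancel₀ hx.ne', Complex.ofReal_one]
    · rw [innerF_self_eq_variance, variance_smul, ht, inv_pow, Real.sq_sqrt hy.le,
        inv_mul_cancel₀ hy.ne', Complex.ofReal_one]
  have hle := le_csSup (bddAbove_valuesHerm hf ρ) hmem
  change _ ≤ mu f ρ at hle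
  rw [h, objective_smul ρ hs0.le ht0.le] at hle
  exact le_antisymm (nonpos_of_mul_nonpos_right hle (mul_pos hs0 ht0)) (objective_nonneg ρ X Y)

end Bounds

/-! ### Local two-outcome measurements -/

section Measure

variable {a b : Type*} [Fintype a] [DecidableEq a] [Fintype b] [DecidableEq b]

lemma Measurement.channel_single (M : Measurement a) (i j : a) :
    M.channel (Matrix.single i j 1) = ∑ x, M.effect x j i • Matrix.single x x (1 : ℂ) := by
  simp [Measurement.channel, Matrix.trace_mul_single]

lemma tensorApply_channel (M : Measurement a) (N : Measurement b)
    (R : Matrix (a × b) (a × b) ℂ) :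
    tensorApply M.channel N.channel R = ∑ x, ∑ y,
      ((M.effect x ⊗ₖ N.effect y) * R).trace •
        (Matrix.single x x (1 : ℂ) ⊗ₖ Matrix.single y y (1 : ℂ)) := by
  ext ⟨x, y⟩ ⟨x', y'⟩
  have hM : ∀ i j, M.channel (Matrix.single i j 1) x x'
      = if x = x' then M.effect x j i else 0 := by
    intro i j
    rw [M.channel_single]
    simp [Matrix.sum_apply, Matrix.single_apply, ite_and]
  have hN : ∀ i j, N.channel (Matrix.single i j 1) y y'
      = if y = y' then N.effect y j i else 0 := by
    intro i j
    rw [N.channel_single]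
    simp [Matrix.sum_apply, Matrix.single_apply, ite_and]
  have hR : (∑ u, ∑ v, ((M.effect u ⊗ₖ N.effect v) * R).trace •
        (Matrix.single u u (1 : ℂ) ⊗ₖ Matrix.single v v (1 : ℂ))) (x, y) (x', y')
      = if x = x' then if y = y' then ((M.effect x ⊗ₖ N.effect y) * R).trace else 0 else 0 := by
    simp [-Fin.sum_univ_two, Matrix.sum_apply, Matrix.single_apply, ite_and]
    split_ifs <;> rfl
  rw [hR]
  simp only [tensorApply, Matrix.sum_apply, Matrix.smul_apply, Matrix.kronecker_apply, hM, hN]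
  split_ifs with h1 h2
  · simp only [Matrix.trace, Matrix.diag_apply, Matrix.mul_apply, Fintype.sum_prod_type,
      Matrix.kronecker_apply, smul_eq_mul]
    rw [Finset.sum_comm]
    refine Finset.sum_congr rfl fun j _ => ?_
    calc _ = ∑ i, ∑ l, ∑ k, R (i, k) (j, l) * (M.effect x j i * N.effect y l k) :=
          Finset.sum_congr rfl fun i _ => Finset.sum_comm
      _ = ∑ l, ∑ i, ∑ k, R (i, k) (j, l) * (M.effect x j i * N.effect y l k) := Finset.sum_comm
      _ = _ := by simp only [mul_comm]
  all_goals simp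

/-- The joint outcome distribution characterizing `χ^{|p}`. -/
lemma tensorApply_channel_eq_chi_iff (M : Measurement a) (N : Measurement b)
    (R : Matrix (a × b) (a × b) ℂ) (p : ℝ) :
    tensorApply M.channel N.channel R = chi p ↔
      ((M.effect 0 ⊗ₖ N.effect 0) * R).trace = p ∧ ((M.effect 0 ⊗ₖ N.effect 1) * R).trace = 0 ∧
      ((M.effect 1 ⊗ₖ N.effect 0) * R).trace = 0 ∧
      ((M.effect 1 ⊗ₖ N.effect 1) * R).trace = (1 - p : ℝ) := by
  rw [tensorApply_channel]
  constructor
  · intro h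
    have h' := fun x y => congrFun (congrFun h (x, y)) (x, y)
    refine ⟨?_, ?_, ?_, ?_⟩
    · simpa [Fin.sum_univ_two, chi, Matrix.single_apply] using h' 0 0
    · simpa [Fin.sum_univ_two, chi, Matrix.single_apply] using h' 0 1
    · simpa [Fin.sum_univ_two, chi, Matrix.single_apply] using h' 1 0
    · simpa [Fin.sum_univ_two, chi, Matrix.single_apply] using h' 1 1
  · rintro ⟨h1, h2, h3, h4⟩
    simp only [Fin.sum_univ_two, h1, h2, h3, h4, zero_smul, add_zero, zero_add, chi]

lemma sqrt_mul_le_perspective_fAM (x y : ℝ) (hx : 0 ≤ x) (hy : 0 ≤ y) :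
    √(x * y) ≤ perspective fAM x y := by
  rw [perspective_fAM]
  refine Real.sqrt_le_iff.2 ⟨by positivity, ?_⟩
  nlinarith [sq_nonneg (x - y)]

lemma ofReal_variance_fAM (σ : State a) {X : Matrix a a ℂ} (hX : X.IsHermitian) :
    (variance fAM σ X : ℂ) = (σ.mat * (X * X)).trace := by
  rw [← innerF_self_eq_variance, innerF_fAM σ hX]

lemma Measurement.effect_one (M : Measurement a) : M.effect 1 = 1 - M.effect 0 := by
  have h := M.sum_one
  rw [Fin.sum_univ_two] at h
  rw [← h, add_sub_cancel_left]

/-- A two-valued observable has variance at most the variance of the outcome distribution. -/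
lemma variance_two_outcome_le (σ : State a) (M : Measurement a) {p α β : ℝ}
    (h0 : (σ.mat * M.effect 0).trace = p) (h1 : (σ.mat * M.effect 1).trace = (1 - p : ℝ)) :
    variance fAM σ ((α : ℂ) • M.effect 0 + (β : ℂ) • M.effect 1)
      ≤ α ^ 2 * p + β ^ 2 * (1 - p) := by
  have hH : ((α : ℂ) • M.effect 0 + (β : ℂ) • M.effect 1).IsHermitian :=
    (isHermitian_ofReal_smul α (M.posSemidef 0).isHermitian).add
      (isHermitian_ofReal_smul β (M.posSemidef 1).isHermitian)
  -- the defect operator `M₀ M₁ = M₀ M₁ M₀ + M₁ M₀ M₁` is positive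
  have hpos : (M.effect 0 * M.effect 1).PosSemidef := by
    have e : M.effect 0 * M.effect 1 = M.effect 0 * M.effect 1 * (M.effect 0)ᴴ
        + M.effect 1 * M.effect 0 * (M.effect 1)ᴴ := by
      rw [(M.posSemidef 0).isHermitian.eq, (M.posSemidef 1).isHermitian.eq, M.effect_one]
      noncomm_ring
    rw [e]
    exact ((M.posSemidef 1).mul_mul_conjTranspose_same _).add
      ((M.posSemidef 0).mul_mul_conjTranspose_same _)
  have hsq : ((α : ℂ) • M.effect 0 + (β : ℂ) • M.effect 1)
      * ((α : ℂ) • M.effect 0 + (β : ℂ) • M.effect 1)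
      = ((α ^ 2 : ℝ) : ℂ) • M.effect 0 + ((β ^ 2 : ℝ) : ℂ) • M.effect 1
        - (((α - β) ^ 2 : ℝ) : ℂ) • (M.effect 0 * M.effect 1) := by
    rw [M.effect_one]
    simp only [mul_add, add_mul, mul_sub, sub_mul, smul_sub, smul_mul_assoc, mul_smul_comm,
      mul_one, one_mul]
    push_cast
    module
  have hv := ofReal_variance_fAM σ hH
  rw [hsq, Matrix.mul_sub, Matrix.mul_add, Matrix.mul_smul, Matrix.mul_smul, Matrix.mul_smul,
    Matrix.trace_sub, Matrix.trace_add, Matrix.trace_smul, Matrix.trace_smul, Matrix.trace_smul,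
    h0, h1] at hv
  have hnn := (Complex.nonneg_iff.1 (trace_mul_nonneg σ.posSemidef hpos)).1
  have hre := congrArg Complex.re hv
  simp only [smul_eq_mul, Complex.ofReal_re, Complex.sub_re, Complex.add_re, Complex.re_ofReal_mul]
    at hre
  rw [hre]
  nlinarith [mul_nonneg (sq_nonneg (α - β)) hnn]

lemma mu_fAM_eq_one_of_measurement {ρ : State (a × b)} {M : Measurement a} {N : Measurement b}
    {p : ℝ} (hp0 : 0 < p) (hp1 : p < 1)
    (h : tensorApply M.channel N.channel ρ.mat = chi p) : mu fAM ρ = 1 := by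
  obtain ⟨h00, h01, h10, h11⟩ := (tensorApply_channel_eq_chi_iff _ _ _ _).1 h
  have hMs : M.effect 0 + M.effect 1 = 1 := by rw [M.effect_one]; abel
  have hNs : N.effect 0 + N.effect 1 = 1 := by rw [N.effect_one]; abel
  have hA : ∀ x, (ρ.margA.mat * M.effect x).trace = ((M.effect x ⊗ₖ N.effect 0) * ρ.mat).trace
      + ((M.effect x ⊗ₖ N.effect 1) * ρ.mat).trace := fun x => by
    rw [Matrix.trace_mul_comm, ← trace_kronecker_one_mul, ← hNs, Matrix.kronecker_add,
      Matrix.add_mul, Matrix.trace_add]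
  have hB : ∀ y, (ρ.margB.mat * N.effect y).trace = ((M.effect 0 ⊗ₖ N.effect y) * ρ.mat).trace
      + ((M.effect 1 ⊗ₖ N.effect y) * ρ.mat).trace := fun y => by
    rw [Matrix.trace_mul_comm, ← trace_one_kronecker_mul, ← hMs, Matrix.add_kronecker,
      Matrix.add_mul, Matrix.trace_add]
  have hA0 : (ρ.margA.mat * M.effect 0).trace = p := by rw [hA, h00, h01, add_zero]
  have hA1 : (ρ.margA.mat * M.effect 1).trace = (1 - p : ℝ) := by rw [hA, h10, h11, zero_add]
  have hB0 : (ρ.margB.mat * N.effect 0).trace = p := by rw [hB, h00, h10, add_zero]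
  have hB1 : (ρ.margB.mat * N.effect 1).trace = (1 - p : ℝ) := by rw [hB, h01, h11, zero_add]
  -- the values of a centered random variable of variance one on the two outcomes
  have hq0 : 0 < 1 - p := by linarith
  set s : ℝ := √p with hs
  set t : ℝ := √(1 - p) with ht
  have hs0 : 0 < s := Real.sqrt_pos.2 hp0
  have ht0 : 0 < t := Real.sqrt_pos.2 hq0
  have hss : s ^ 2 = p := Real.sq_sqrt hp0.le
  have htt : t ^ 2 = 1 - p := Real.sq_sqrt hq0.le
  set α : ℝ := t / s with hα
  set β : ℝ := -(s / t) with hβ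
  have hmean : α * p + β * (1 - p) = 0 := by
    rw [hα, hβ, ← htt, ← hss]; field_simp; ring
  have hvar : α ^ 2 * p + β ^ 2 * (1 - p) = 1 := by
    have h1 : α * s = t := div_mul_cancel₀ _ hs0.ne'
    have h2 : β * t = -s := by rw [hβ, neg_mul, div_mul_cancel₀ _ ht0.ne']
    linear_combination -(α ^ 2) * hss - β ^ 2 * htt + (α * s + t) * h1 + (β * t - s) * h2
      + hss + htt
  set X := (α : ℂ) • M.effect 0 + (β : ℂ) • M.effect 1 with hX
  set Y := (α : ℂ) • N.effect 0 + (β : ℂ) • N.effect 1 with hY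
  have hXh : X.IsHermitian := (isHermitian_ofReal_smul α (M.posSemidef 0).isHermitian).add
    (isHermitian_ofReal_smul β (M.posSemidef 1).isHermitian)
  have hYh : Y.IsHermitian := (isHermitian_ofReal_smul α (N.posSemidef 0).isHermitian).add
    (isHermitian_ofReal_smul β (N.posSemidef 1).isHermitian)
  have hobj : objective ρ X Y = 1 := by
    have : ((X ⊗ₖ Yᴴ) * ρ.mat).trace = ((α ^ 2 * p + β ^ 2 * (1 - p) : ℝ) : ℂ) := by
      rw [hYh.eq, hX, hY]
      simp only [Matrix.add_kronecker, Matrix.kronecker_add, Matrix.smul_kronecker,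
        Matrix.kronecker_smul, Matrix.add_mul, Matrix.smul_mul, Matrix.trace_add,
        Matrix.trace_smul, h00, h01, h10, h11, smul_eq_mul]
      push_cast
      ring
    rw [objective, this, hvar, Complex.ofReal_one, norm_one]
  have hXv : variance fAM ρ.margA X ≤ 1 := hvar ▸ variance_two_outcome_le _ M hA0 hA1
  have hYv : variance fAM ρ.margB Y ≤ 1 := hvar ▸ variance_two_outcome_le _ N hB0 hB1
  -- the Cauchy–Schwarz inequality forces both variances to be equal to one
  have hcs := objective_sq_le_mul_variance sqrt_mul_le_perspective_fAM ρ X Y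
  rw [hobj, one_pow] at hcs
  have hnn : ∀ x y : ℝ, 0 ≤ x → 0 ≤ y → 0 ≤ perspective fAM x y := fun x y hx hy =>
    (Real.sqrt_nonneg _).trans (sqrt_mul_le_perspective_fAM x y hx hy)
  have hXnn : 0 ≤ variance fAM ρ.margA X := wSq_nonneg (fun i j =>
    hnn _ _ (ρ.margA.eigval_nonneg i) (ρ.margA.eigval_nonneg j)) _
  have hYnn : 0 ≤ variance fAM ρ.margB Y := wSq_nonneg (fun i j =>
    hnn _ _ (ρ.margB.eigval_nonneg i) (ρ.margB.eigval_nonneg j)) _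
  have hX1 : variance fAM ρ.margA X = 1 := by nlinarith
  have hY1 : variance fAM ρ.margB Y = 1 := by nlinarith
  have hf1 : fAM 1 = 1 := by norm_num [fAM]
  have hfeas : Feasible fAM ρ X Y := by
    refine ⟨?_, ?_, ?_, ?_⟩
    · rw [innerF_one _ hf1, hX, Matrix.mul_add, Matrix.mul_smul, Matrix.mul_smul,
        Matrix.trace_add, Matrix.trace_smul, Matrix.trace_smul, hA0, hA1, smul_eq_mul,
        smul_eq_mul]
      exact_mod_cast hmean
    · rw [innerF_one _ hf1, hY, Matrix.mul_add, Matrix.mul_smul, Matrix.mul_smul,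
        Matrix.trace_add, Matrix.trace_smul, Matrix.trace_smul, hB0, hB1, smul_eq_mul,
        smul_eq_mul]
      exact_mod_cast hmean
    · rw [innerF_self_eq_variance, hX1, Complex.ofReal_one]
    · rw [innerF_self_eq_variance, hY1, Complex.ofReal_one]
  have hub : ∀ r ∈ valuesHerm fAM ρ, r ≤ 1 := by
    rintro _ ⟨X, Y, -, -, h, rfl⟩
    exact h.objective_le_one sqrt_mul_le_perspective_fAM
  refine le_antisymm (Real.sSup_le hub zero_le_one) (le_csSup ⟨1, hub⟩ ?_)
  exact ⟨X, Y, hXh, hYh, hfeas, hobj.symm⟩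

end Measure

/-! ### Extremal observables for the arithmetic mean -/

section Extremal

lemma mul_eq_zero_of_trace_eq_zero {n : Type*} [Fintype n] {A B : Matrix n n ℂ}
    (hA : A.PosSemidef) (hB : B.PosSemidef) (h : (A * B).trace = 0) : A * B = 0 := by
  obtain ⟨C, rfl⟩ := exists_eq_conjTranspose_mul_self hB
  rw [← Matrix.mul_assoc, Matrix.trace_mul_comm, ← Matrix.mul_assoc] at h
  have h0 := (hA.mul_mul_conjTranspose_same C).trace_eq_zero_iff.1 h
  obtain ⟨D, rfl⟩ := exists_eq_conjTranspose_mul_self hA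
  have h1 : (D * Cᴴ)ᴴ * (D * Cᴴ) = 0 := by
    rw [Matrix.conjTranspose_mul, Matrix.conjTranspose_conjTranspose, ← h0]
    simp only [Matrix.mul_assoc]
  rw [Matrix.conjTranspose_mul_self_eq_zero] at h1
  rw [← Matrix.mul_assoc, Matrix.mul_assoc Dᴴ, h1, Matrix.mul_zero, Matrix.zero_mul]

section Compact

variable {n : Type*} [Fintype n] [DecidableEq n]

/-- The matrices, in the eigenbasis of `σ`, of the centered Hermitian operators on the support of
`σ` with arithmetic mean variance at most one. -/
def compressedBall (σ : State n) : Set (Matrix n n ℂ) :=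
  {Z | (∀ i j, star (Z i j) = Z j i) ∧ (∀ i j, σ.eigval i * σ.eigval j = 0 → Z i j = 0) ∧
    wSq (fun i j => perspective fAM (σ.eigval i) (σ.eigval j)) Z ≤ 1 ∧
    ∑ i, (σ.eigval i : ℂ) * Z i i = 0}

lemma isCompact_compressedBall (σ : State n) : IsCompact (compressedBall σ) := by
  have hcl : IsClosed (compressedBall σ) := by
    simp only [compressedBall, Set.ofPred_and, Set.ofPred_forall, wSq]
    refine IsClosed.inter ?_ (IsClosed.inter ?_ (IsClosed.inter ?_ ?_))
    · exact isClosed_iInter fun i => isClosed_iInter fun j =>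
        isClosed_eq (by fun_prop) (by fun_prop)
    · exact isClosed_iInter fun i => isClosed_iInter fun j => isClosed_iInter fun _ =>
        isClosed_eq (by fun_prop) (by fun_prop)
    · exact isClosed_le (by fun_prop) (by fun_prop)
    · exact isClosed_eq (by fun_prop) (by fun_prop)
  have hbox : IsCompact (Set.pi Set.univ fun i => Set.pi Set.univ fun j =>
      Metric.closedBall (0 : ℂ) √(2 / (σ.eigval i + σ.eigval j)) : Set (n → n → ℂ)) :=
    isCompact_univ_pi fun i => isCompact_univ_pi fun j => isCompact_closedBall _ _
  refine IsCompact.of_isClosed_subset hbox hcl ?_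
  rintro Z ⟨-, hsupp, hvar, -⟩ i - j -
  rw [mem_closedBall_zero_iff]
  by_cases h0 : σ.eigval i * σ.eigval j = 0
  · rw [hsupp i j h0, norm_zero]
    exact Real.sqrt_nonneg _
  have hi := (σ.eigval_nonneg i).lt_of_ne' (left_ne_zero_of_mul h0)
  have hj := (σ.eigval_nonneg j).lt_of_ne' (right_ne_zero_of_mul h0)
  refine Real.le_sqrt_of_sq_le ?_
  have hnn : ∀ i j, 0 ≤ perspective fAM (σ.eigval i) (σ.eigval j) * ‖Z i j‖ ^ 2 := fun i j => by
    rw [perspective_fAM]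
    exact mul_nonneg (by linarith [σ.eigval_nonneg i, σ.eigval_nonneg j]) (sq_nonneg _)
  have h1 : perspective fAM (σ.eigval i) (σ.eigval j) * ‖Z i j‖ ^ 2 ≤ 1 :=
    ((Finset.single_le_sum (f := fun j => perspective fAM (σ.eigval i) (σ.eigval j) * ‖Z i j‖ ^ 2)
      (fun j _ => hnn i j) (Finset.mem_univ j)).trans
      (Finset.single_le_sum
        (f := fun i => ∑ j, perspective fAM (σ.eigval i) (σ.eigval j) * ‖Z i j‖ ^ 2)
        (fun i _ => Finset.sum_nonneg fun j _ => hnn i j) (Finset.mem_univ i))).trans hvar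
  rw [perspective_fAM] at h1
  rw [le_div_iff₀ (by linarith)]
  linarith

lemma zero_mem_compressedBall (σ : State n) : 0 ∈ compressedBall σ :=
  ⟨by simp, by simp, by simp [wSq], by simp⟩

lemma isHermitian_unhat {σ : State n} {Z : Matrix n n ℂ} (hZ : Z ∈ compressedBall σ) :
    (σ.unhat Z).IsHermitian := by
  have : Zᴴ = Z := by
    ext i j
    rw [Matrix.conjTranspose_apply, hZ.1]
  rw [Matrix.IsHermitian, ← σ.unhat_conjTranspose, this]

/-- Compression of a centered Hermitian operator to the support of `σ`. -/
lemma exists_compression (σ : State n) {X : Matrix n n ℂ} (hX : X.IsHermitian)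
    (hmean : (σ.mat * X).trace = 0) (hvar : variance fAM σ X ≤ 1) :
    ∃ Z ∈ compressedBall σ,
      wSq (fun i j => √(σ.eigval i * σ.eigval j)) (σ.hat (X - σ.unhat Z)) = 0 := by
  have hh : ∀ i j, star (σ.hat X i j) = σ.hat X j i := by
    intro i j
    rw [← Matrix.conjTranspose_apply, ← σ.hat_conjTranspose, hX.eq]
  let Z : Matrix n n ℂ := Matrix.of fun i j =>
    if σ.eigval i * σ.eigval j = 0 then 0 else σ.hat X i j
  have hZ : ∀ i j, Z i j = if σ.eigval i * σ.eigval j = 0 then 0 else σ.hat X i j :=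
    fun i j => rfl
  refine ⟨Z, ⟨fun i j => ?_, fun i j h => ?_, ?_, ?_⟩, ?_⟩
  · rw [hZ, hZ, mul_comm (σ.eigval j), apply_ite star, star_zero, hh]
  · rw [hZ, if_pos h]
  · refine le_trans (Finset.sum_le_sum fun i _ => Finset.sum_le_sum fun j _ => ?_) hvar
    have hnn : 0 ≤ perspective fAM (σ.eigval i) (σ.eigval j) := by
      rw [perspective_fAM]
      linarith [σ.eigval_nonneg i, σ.eigval_nonneg j]
    refine mul_le_mul_of_nonneg_left ?_ hnn
    rw [hZ]
    split_ifs
    · rw [norm_zero, zero_pow two_ne_zero]; exact sq_nonneg _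
    · exact le_rfl
  · rw [← hmean, ← σ.trace_hat, σ.hat_mul, σ.hat_mat]
    simp only [Matrix.trace, Matrix.diag_apply, Matrix.diagonal_mul]
    refine Finset.sum_congr rfl fun i _ => ?_
    rw [hZ]
    split_ifs with h
    · rw [mul_self_eq_zero] at h
      simp [h]
    · rfl
  · have hsub : σ.hat (X - σ.unhat Z) = σ.hat X - Z := by
      rw [State.hat, Matrix.mul_sub, Matrix.sub_mul]
      exact congrArg _ (σ.hat_unhat Z)
    rw [hsub]
    refine Finset.sum_eq_zero fun i _ => Finset.sum_eq_zero fun j _ => ?_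
    rw [Matrix.sub_apply, hZ]
    split_ifs with h
    · simp only [h, Real.sqrt_zero, zero_mul]
    · rw [sub_self, norm_zero, zero_pow two_ne_zero, mul_zero]

end Compact

variable {a b : Type*} [Fintype a] [DecidableEq a] [Fintype b] [DecidableEq b]

/-- The supremum defining `μ_AM` is attained on operators supported on the marginals. -/
lemma exists_maximizer {ρ : State (a × b)} (h : mu fAM ρ = 1) :
    ∃ (X : Matrix a a ℂ) (Y : Matrix b b ℂ), X.IsHermitian ∧ Y.IsHermitian ∧
      (ρ.margA.mat * X).trace = 0 ∧ variance fAM ρ.margA X ≤ 1 ∧ variance fAM ρ.margB Y ≤ 1 ∧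
      1 ≤ objective ρ X Y := by
  have hcomp := (isCompact_compressedBall ρ.margA).prod (isCompact_compressedBall ρ.margB)
  have hcont : Continuous fun p : Matrix a a ℂ × Matrix b b ℂ =>
      objective ρ (ρ.margA.unhat p.1) (ρ.margB.unhat p.2) := by
    unfold objective State.unhat
    simp only [trace_kronecker_mul, slice, Matrix.of_apply, Matrix.mul_apply]
    fun_prop
  obtain ⟨⟨Z, W⟩, ⟨hZ, hW⟩, hmax⟩ := hcomp.exists_isMaxOn
    ⟨(0, 0), zero_mem_compressedBall _, zero_mem_compressedBall _⟩ hcont.continuousOn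
  refine ⟨ρ.margA.unhat Z, ρ.margB.unhat W, isHermitian_unhat hZ, isHermitian_unhat hW,
    ?_, ?_, ?_, ?_⟩
  · rw [← ρ.margA.trace_hat, State.hat_mul, State.hat_mat, State.hat_unhat]
    simpa only [Matrix.trace, Matrix.diag_apply, Matrix.diagonal_mul] using hZ.2.2.2
  · rw [variance, State.hat_unhat]; exact hZ.2.2.1
  · rw [variance, State.hat_unhat]; exact hW.2.2.1
  rw [← h]
  refine Real.sSup_le ?_ (objective_nonneg _ _ _)
  rintro _ ⟨X, Y, hX, hY, hf, rfl⟩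
  have hf1 : fAM 1 = 1 := by norm_num [fAM]
  have hmX := hf.mean_left
  have hmY := hf.mean_right
  rw [innerF_one _ hf1] at hmX hmY
  obtain ⟨Z', hZ', hXZ⟩ := exists_compression ρ.margA hX hmX hf.variance_left.le
  obtain ⟨W', hW', hYW⟩ := exists_compression ρ.margB hY hmY hf.variance_right.le
  refine le_trans (le_of_eq ?_) (hmax (Set.mk_mem_prod hZ' hW'))
  have h1 := objective_sq_le ρ (X - ρ.margA.unhat Z') Y
  have h2 := objective_sq_le ρ (ρ.margA.unhat Z') (Y - ρ.margB.unhat W')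
  rw [hXZ, zero_mul] at h1
  rw [hYW, mul_zero] at h2
  have h1' := norm_eq_zero.1 (pow_eq_zero_iff two_ne_zero |>.1 (le_antisymm h1 (sq_nonneg _)))
  have h2' := norm_eq_zero.1 (pow_eq_zero_iff two_ne_zero |>.1 (le_antisymm h2 (sq_nonneg _)))
  change _ = ‖((ρ.margA.unhat Z' ⊗ₖ (ρ.margB.unhat W')ᴴ) * ρ.mat).trace‖
  have hexp : X ⊗ₖ Yᴴ = (X - ρ.margA.unhat Z') ⊗ₖ Yᴴ
      + ρ.margA.unhat Z' ⊗ₖ (Y - ρ.margB.unhat W')ᴴ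
      + ρ.margA.unhat Z' ⊗ₖ (ρ.margB.unhat W')ᴴ := by
    ext ⟨i, k⟩ ⟨j, l⟩
    simp only [Matrix.kronecker_apply, Matrix.sub_apply, Matrix.add_apply,
      Matrix.conjTranspose_sub]
    ring
  rw [objective, hexp, Matrix.add_mul, Matrix.add_mul, Matrix.trace_add, Matrix.trace_add, h1',
    h2', zero_add, zero_add]

/-- Perfectly correlated observables coincide on the state: `Tr[(X ⊗ 1 - 1 ⊗ Y)² ρ] ≤ 0`. -/
lemma exists_coinciding_observables {ρ : State (a × b)} (h : mu fAM ρ = 1) :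
    ∃ (X : Matrix a a ℂ) (Y : Matrix b b ℂ), X.IsHermitian ∧ Y.IsHermitian ∧
      (ρ.margA.mat * X).trace = 0 ∧ ρ.margA.mat * X ≠ 0 ∧
      (X ⊗ₖ (1 : Matrix b b ℂ)) * ρ.mat = ((1 : Matrix a a ℂ) ⊗ₖ Y) * ρ.mat := by
  obtain ⟨X, Y, hX, hY, hmean, hvX, hvY, hobj⟩ := exists_maximizer h
  -- flip the sign of `Y` so that the correlation is positive
  obtain ⟨Y', hY', hvY', hc⟩ : ∃ Y' : Matrix b b ℂ, Y'.IsHermitian ∧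
      (ρ.margB.mat * (Y' * Y')).trace.re ≤ 1 ∧ 1 ≤ ((X ⊗ₖ Y') * ρ.mat).trace.re := by
    have hvY2 : (ρ.margB.mat * (Y * Y)).trace.re ≤ 1 := by
      rw [← ofReal_variance_fAM _ hY, Complex.ofReal_re]; exact hvY
    have hreal : ((X ⊗ₖ Y) * ρ.mat).trace = (((X ⊗ₖ Y) * ρ.mat).trace.re : ℂ) := by
      have : star ((X ⊗ₖ Y) * ρ.mat).trace = ((X ⊗ₖ Y) * ρ.mat).trace := by
        rw [← Matrix.trace_conjTranspose, Matrix.conjTranspose_mul, Matrix.conjTranspose_kronecker,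
          hX.eq, hY.eq, ρ.posSemidef.isHermitian.eq, Matrix.trace_mul_comm]
      exact (Complex.conj_eq_iff_re.1 this).symm
    rw [objective, hY.eq, hreal, Complex.norm_real, Real.norm_eq_abs] at hobj
    rcases le_abs'.1 hobj with hneg | hpos
    · refine ⟨-Y, hY.neg, by simpa using hvY2, ?_⟩
      rw [show X ⊗ₖ (-Y) = -(X ⊗ₖ Y) by ext; simp, Matrix.neg_mul, Matrix.trace_neg,
        Complex.neg_re]
      linarith
    · exact ⟨Y, hY, hvY2, hpos⟩
  have hvX2 : (ρ.margA.mat * (X * X)).trace.re ≤ 1 := by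
    rw [← ofReal_variance_fAM _ hX, Complex.ofReal_re]; exact hvX
  set D := X ⊗ₖ (1 : Matrix b b ℂ) - (1 : Matrix a a ℂ) ⊗ₖ Y' with hD
  have hDh : Dᴴ = D := by
    rw [hD, Matrix.conjTranspose_sub, Matrix.conjTranspose_kronecker,
      Matrix.conjTranspose_kronecker, hX.eq, hY'.eq, Matrix.conjTranspose_one,
      Matrix.conjTranspose_one]
  have htr : ((Dᴴ * D) * ρ.mat).trace = (ρ.margA.mat * (X * X)).trace
      + (ρ.margB.mat * (Y' * Y')).trace - 2 * ((X ⊗ₖ Y') * ρ.mat).trace := by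
    have : Dᴴ * D = (X * X) ⊗ₖ (1 : Matrix b b ℂ) + (1 : Matrix a a ℂ) ⊗ₖ (Y' * Y')
        - (2 : ℂ) • (X ⊗ₖ Y') := by
      rw [hDh, hD, Matrix.sub_mul, Matrix.mul_sub, Matrix.mul_sub, ← Matrix.mul_kronecker_mul,
        ← Matrix.mul_kronecker_mul, ← Matrix.mul_kronecker_mul, ← Matrix.mul_kronecker_mul,
        Matrix.mul_one, Matrix.mul_one, Matrix.one_mul, Matrix.one_mul, Matrix.mul_one,
        Matrix.one_mul, two_smul]
      abel
    rw [this, Matrix.sub_mul, Matrix.add_mul, Matrix.smul_mul, Matrix.trace_sub, Matrix.trace_add,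
      Matrix.trace_smul, trace_kronecker_one_mul, trace_one_kronecker_mul,
      Matrix.trace_mul_comm (X * X), Matrix.trace_mul_comm (Y' * Y'), smul_eq_mul]
  have hDp : (Dᴴ * D).PosSemidef := Matrix.posSemidef_conjTranspose_mul_self D
  have hnn := Complex.nonneg_iff.1 (trace_mul_nonneg hDp ρ.posSemidef)
  have hre : ((Dᴴ * D) * ρ.mat).trace.re = (ρ.margA.mat * (X * X)).trace.re
      + (ρ.margB.mat * (Y' * Y')).trace.re - 2 * ((X ⊗ₖ Y') * ρ.mat).trace.re := by
    rw [htr]; simp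
  have h0 : ((Dᴴ * D) * ρ.mat).trace = 0 :=
    Complex.ext (le_antisymm (by rw [hre, Complex.zero_re]; linarith) hnn.1) hnn.2.symm
  have hDρ : D * ρ.mat = 0 := by
    rw [← Matrix.conjTranspose_mul_self_eq_zero, Matrix.conjTranspose_mul, Matrix.mul_assoc,
      ← Matrix.mul_assoc Dᴴ, mul_eq_zero_of_trace_eq_zero hDp ρ.posSemidef h0, Matrix.mul_zero]
  refine ⟨X, Y', hX, hY', hmean, fun hσ => ?_, ?_⟩
  · have h1 := hnn.1
    rw [hre, ← Matrix.mul_assoc, hσ, Matrix.zero_mul, Matrix.trace_zero, Complex.zero_re] at h1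
    linarith
  · rwa [hD, Matrix.sub_mul, sub_eq_zero] at hDρ

/-- Functions of coinciding observables coincide. -/
lemma cfc_kronecker_mul_eq {R : Matrix (a × b) (a × b) ℂ} {X : Matrix a a ℂ} {Y : Matrix b b ℂ}
    (hX : X.IsHermitian) (hY : Y.IsHermitian)
    (h : (X ⊗ₖ (1 : Matrix b b ℂ)) * R = ((1 : Matrix a a ℂ) ⊗ₖ Y) * R) (g : ℝ → ℝ) :
    (cfc g X ⊗ₖ (1 : Matrix b b ℂ)) * R = ((1 : Matrix a a ℂ) ⊗ₖ cfc g Y) * R := by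
  have hpow : ∀ m : ℕ, ((X ^ m) ⊗ₖ (1 : Matrix b b ℂ)) * R
      = ((1 : Matrix a a ℂ) ⊗ₖ (Y ^ m)) * R := by
    intro m
    induction m with
    | zero => simp
    | succ m ih =>
      have e1 : (X ^ (m + 1)) ⊗ₖ (1 : Matrix b b ℂ)
          = ((X ^ m) ⊗ₖ (1 : Matrix b b ℂ)) * (X ⊗ₖ (1 : Matrix b b ℂ)) := by
        rw [← Matrix.mul_kronecker_mul, Matrix.mul_one, pow_succ]
      have e2 : ((X ^ m) ⊗ₖ (1 : Matrix b b ℂ)) * ((1 : Matrix a a ℂ) ⊗ₖ Y)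
          = ((1 : Matrix a a ℂ) ⊗ₖ Y) * ((X ^ m) ⊗ₖ (1 : Matrix b b ℂ)) := by
        rw [← Matrix.mul_kronecker_mul, ← Matrix.mul_kronecker_mul]
        simp
      rw [e1, Matrix.mul_assoc, h, ← Matrix.mul_assoc, e2, Matrix.mul_assoc, ih,
        ← Matrix.mul_assoc, ← Matrix.mul_kronecker_mul, Matrix.mul_one, ← pow_succ']
  have hpoly : ∀ q : Polynomial ℝ, (Polynomial.aeval X q ⊗ₖ (1 : Matrix b b ℂ)) * R
      = ((1 : Matrix a a ℂ) ⊗ₖ Polynomial.aeval Y q) * R := by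
    intro q
    simp only [Polynomial.aeval_eq_sum_range]
    induction Finset.range (q.natDegree + 1) using Finset.induction_on with
    | empty => simp
    | insert m s hm ih =>
      rw [Finset.sum_insert hm, Finset.sum_insert hm, Matrix.add_kronecker, Matrix.kronecker_add,
        Matrix.add_mul, Matrix.add_mul, ih, Matrix.smul_kronecker, Matrix.kronecker_smul,
        Matrix.smul_mul, Matrix.smul_mul, hpow]
  -- interpolate `g` on both spectra
  set s : Finset ℝ := X.finite_real_spectrum.toFinset ∪ Y.finite_real_spectrum.toFinset with hs
  set q : Polynomial ℝ := Lagrange.interpolate s id g with hq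
  have hqg : ∀ x ∈ s, g x = q.eval x := fun x hx =>
    (Lagrange.eval_interpolate_at_node (v := id) g Function.injective_id.injOn hx).symm
  have hcX : cfc g X = Polynomial.aeval X q := by
    rw [← cfc_polynomial q X hX]
    exact cfc_congr fun x hx => hqg x (by simp [hs, hx])
  have hcY : cfc g Y = Polynomial.aeval Y q := by
    rw [← cfc_polynomial q Y hY]
    exact cfc_congr fun x hx => hqg x (by simp [hs, hx])
  rw [hcX, hcY, hpoly]

end Extremal

/-! ### From coinciding observables to projective measurements -/

section Projective

variable {n : Type*} [Fintype n] [DecidableEq n]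

/-- The measurement of a projection and its complement. -/
noncomputable def Measurement.ofProjection (P : Matrix n n ℂ) (hP : IsStarProjection P) :
    Measurement n where
  effect := ![P, 1 - P]
  posSemidef := by
    have h : ∀ Q : Matrix n n ℂ, IsStarProjection Q → Q.PosSemidef := fun Q hQ => by
      have e : Qᴴ * Q = Q := by
        rw [← Matrix.star_eq_conjTranspose, hQ.isSelfAdjoint.star_eq, hQ.isIdempotentElem.eq]
      rw [← e]
      exact Matrix.posSemidef_conjTranspose_mul_self Q
    intro x
    fin_cases x
    · exact h P hP
    · exact h (1 - P) hP.one_sub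
  sum_one := by simp [Fin.sum_univ_two]

lemma Measurement.isProjective_ofProjection {P : Matrix n n ℂ} (hP : IsStarProjection P) :
    (Measurement.ofProjection P hP).IsProjective := by
  intro x
  fin_cases x
  · exact hP
  · exact hP.one_sub

/-- The spectral projection of a Hermitian matrix onto the positive half-line. -/
noncomputable def posProj (X : Matrix n n ℂ) : Matrix n n ℂ :=
  cfc (fun x : ℝ => if 0 < x then (1 : ℝ) else 0) X

lemma continuousOn_spectrum (X : Matrix n n ℂ) (g : ℝ → ℝ) : ContinuousOn g (spectrum ℝ X) :=
  X.finite_real_spectrum.continuousOn g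

lemma isStarProjection_posProj (X : Matrix n n ℂ) : IsStarProjection (posProj X) := by
  have hc := continuousOn_spectrum X
  refine ⟨?_, cfc_predicate _ X⟩
  rw [IsIdempotentElem, posProj, ← cfc_mul _ _ X (hc _) (hc _)]
  exact cfc_congr fun x _ => by simp

open scoped MatrixOrder in
lemma posSemidef_mul_posProj {X : Matrix n n ℂ} (hX : X.IsHermitian) :
    (X * posProj X).PosSemidef := by
  have hc := continuousOn_spectrum X
  have e : X * posProj X = cfc (fun x : ℝ => x * if 0 < x then (1 : ℝ) else 0) X := by
    rw [cfc_mul _ _ X (hc _) (hc _), cfc_id' ℝ X hX.isSelfAdjoint, posProj]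
  rw [← Matrix.nonneg_iff_posSemidef, e]
  refine cfc_nonneg fun x _ => ?_
  split_ifs with h
  · simpa using h.le
  · simp

open scoped MatrixOrder in
lemma posSemidef_neg_mul_one_sub_posProj {X : Matrix n n ℂ} (hX : X.IsHermitian) :
    (-(X * (1 - posProj X))).PosSemidef := by
  have hc := continuousOn_spectrum X
  have e : -(X * (1 - posProj X))
      = cfc (fun x : ℝ => (x * if 0 < x then (1 : ℝ) else 0) - x) X := by
    rw [cfc_sub _ _ X (hc _) (hc _), cfc_mul _ _ X (hc _) (hc _), cfc_id' ℝ X hX.isSelfAdjoint,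
      posProj, Matrix.mul_sub, Matrix.mul_one, neg_sub]
  rw [← Matrix.nonneg_iff_posSemidef, e]
  refine cfc_nonneg fun x _ => ?_
  split_ifs with h
  · simp
  · simp only [mul_zero, zero_sub]; linarith

lemma posProj_mul_comm {X : Matrix n n ℂ} (hX : X.IsHermitian) :
    posProj X * X = X * posProj X := by
  have h := (cfc_commute_cfc (fun x : ℝ => if 0 < x then (1 : ℝ) else 0) (fun x : ℝ => x) X).eq
  rwa [cfc_id' ℝ X hX.isSelfAdjoint] at h

/-- A centered observable which is not almost surely zero takes positive and nonpositive values
with positive probability. -/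
lemma exists_trace_posProj {σ : State n} {X : Matrix n n ℂ} (hX : X.IsHermitian)
    (hmean : (σ.mat * X).trace = 0) (hne : σ.mat * X ≠ 0) :
    ∃ p : ℝ, 0 < p ∧ p < 1 ∧ (σ.mat * posProj X).trace = p := by
  set P := posProj X with hP
  have hproj := isStarProjection_posProj X
  have hpsd0 : P.PosSemidef := (Measurement.ofProjection P hproj).posSemidef 0
  have hpsd1 : (1 - P).PosSemidef := (Measurement.ofProjection P hproj).posSemidef 1
  have hp0 : 0 ≤ (σ.mat * P).trace := trace_mul_nonneg σ.posSemidef hpsd0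
  have hp1 : 0 ≤ (σ.mat * (1 - P)).trace := trace_mul_nonneg σ.posSemidef hpsd1
  have h1 : (σ.mat * (1 - P)).trace = 1 - (σ.mat * P).trace := by
    rw [Matrix.mul_sub, Matrix.mul_one, Matrix.trace_sub, σ.trace_one]
  have hsum : σ.mat * X = σ.mat * (X * P) - σ.mat * -(X * (1 - P)) := by
    rw [← Matrix.mul_sub]
    congr 1
    noncomm_ring
  -- if one of the two parts of `X` vanishes on the state, then so does the other
  have hpos : σ.mat * (X * P) = 0 ↔ σ.mat * -(X * (1 - P)) = 0 := by
    have ht : (σ.mat * (X * P)).trace = (σ.mat * -(X * (1 - P))).trace := by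
      rw [hsum, Matrix.trace_sub] at hmean
      exact sub_eq_zero.1 hmean
    constructor
    · intro h
      rw [h, Matrix.trace_zero] at ht
      exact mul_eq_zero_of_trace_eq_zero σ.posSemidef (posSemidef_neg_mul_one_sub_posProj hX)
        ht.symm
    · intro h
      rw [h, Matrix.trace_zero] at ht
      exact mul_eq_zero_of_trace_eq_zero σ.posSemidef (posSemidef_mul_posProj hX) ht
  have hcomm : P * X = X * P := posProj_mul_comm hX
  have hre : (σ.mat * P).trace = ((σ.mat * P).trace.re : ℂ) := by
    refine Complex.ext rfl ?_
    rw [Complex.ofReal_im]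
    exact (Complex.nonneg_iff.1 hp0).2.symm
  refine ⟨(σ.mat * P).trace.re, ?_, ?_, hre⟩
  · refine (Complex.nonneg_iff.1 hp0).1.lt_of_ne' fun h => hne ?_
    rw [h, Complex.ofReal_zero] at hre
    have h0 : σ.mat * (X * P) = 0 := by
      rw [← hcomm, ← Matrix.mul_assoc, mul_eq_zero_of_trace_eq_zero σ.posSemidef hpsd0 hre,
        Matrix.zero_mul]
    rw [hsum, h0, hpos.1 h0, sub_zero]
  · refine lt_of_le_of_ne ?_ fun h => hne ?_
    · have := (Complex.nonneg_iff.1 hp1).1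
      rw [h1, Complex.sub_re, Complex.one_re] at this
      linarith
    · rw [h, Complex.ofReal_one] at hre
      have hz : (σ.mat * (1 - P)).trace = 0 := by rw [h1, hre, sub_self]
      have h0 : σ.mat * -(X * (1 - P)) = 0 := by
        have : -(X * (1 - P)) = (1 - P) * -X := by
          rw [Matrix.sub_mul, Matrix.mul_sub, Matrix.mul_neg, Matrix.mul_neg, hcomm]
          noncomm_ring
        rw [this, ← Matrix.mul_assoc, mul_eq_zero_of_trace_eq_zero σ.posSemidef hpsd1 hz,
          Matrix.zero_mul]
      rw [hsum, h0, hpos.2 h0, sub_zero]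

variable {a b : Type*} [Fintype a] [DecidableEq a] [Fintype b] [DecidableEq b]

/-- The projections onto the positive parts of two coinciding observables are perfectly
correlated. -/
lemma exists_projective_of_mu_eq_one {ρ : State (a × b)} (h : mu fAM ρ = 1) :
    ∃ (M : Measurement a) (N : Measurement b) (p : ℝ), M.IsProjective ∧ N.IsProjective ∧
      0 < p ∧ p < 1 ∧ tensorApply M.channel N.channel ρ.mat = chi p := by
  obtain ⟨X, Y, hX, hY, hmean, hne, hXY⟩ := exists_coinciding_observables h
  obtain ⟨p, hp0, hp1, hp⟩ := exists_trace_posProj hX hmean hne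
  have hPQ : (posProj X ⊗ₖ (1 : Matrix b b ℂ)) * ρ.mat
      = ((1 : Matrix a a ℂ) ⊗ₖ posProj Y) * ρ.mat := cfc_kronecker_mul_eq hX hY hXY _
  have hP := isStarProjection_posProj X
  have hQ := isStarProjection_posProj Y
  set P := posProj X
  set Q := posProj Y
  have hl : ∀ P' : Matrix a a ℂ, (P' ⊗ₖ Q) * ρ.mat = ((P' * P) ⊗ₖ (1 : Matrix b b ℂ)) * ρ.mat := by
    intro P'
    have e1 : P' ⊗ₖ Q = (P' ⊗ₖ (1 : Matrix b b ℂ)) * ((1 : Matrix a a ℂ) ⊗ₖ Q) := by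
      rw [← Matrix.mul_kronecker_mul, Matrix.mul_one, Matrix.one_mul]
    rw [e1, Matrix.mul_assoc, ← hPQ, ← Matrix.mul_assoc, ← Matrix.mul_kronecker_mul,
      Matrix.mul_one]
  have hp' : ((P ⊗ₖ (1 : Matrix b b ℂ)) * ρ.mat).trace = p := by
    rw [trace_kronecker_one_mul, Matrix.trace_mul_comm, hp]
  have h00 : ((P ⊗ₖ Q) * ρ.mat).trace = p := by
    rw [hl, hP.isIdempotentElem.eq, hp']
  have h10 : (((1 - P) ⊗ₖ Q) * ρ.mat).trace = 0 := by
    rw [hl, Matrix.sub_mul, Matrix.one_mul, hP.isIdempotentElem.eq, sub_self]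
    simp
  have h01 : ((P ⊗ₖ (1 - Q)) * ρ.mat).trace = 0 := by
    have : P ⊗ₖ (1 - Q) = P ⊗ₖ (1 : Matrix b b ℂ) - P ⊗ₖ Q := by
      ext; simp [mul_sub]
    rw [this, Matrix.sub_mul, Matrix.trace_sub, hp', h00, sub_self]
  have h11 : (((1 - P) ⊗ₖ (1 - Q)) * ρ.mat).trace = ((1 - p : ℝ) : ℂ) := by
    have : (1 - P) ⊗ₖ (1 - Q) = (1 : Matrix (a × b) (a × b) ℂ) - P ⊗ₖ (1 : Matrix b b ℂ)
        - (1 - P) ⊗ₖ Q := by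
      rw [← Matrix.one_kronecker_one]
      ext ⟨i, k⟩ ⟨j, l⟩
      simp only [Matrix.kronecker_apply, Matrix.sub_apply]
      ring
    rw [this, Matrix.sub_mul, Matrix.sub_mul, Matrix.trace_sub, Matrix.trace_sub, hp', h10,
      Matrix.one_mul, ρ.trace_one, sub_zero]
    push_cast
    rfl
  exact ⟨.ofProjection P hP, .ofProjection Q hQ, p, Measurement.isProjective_ofProjection hP,
    Measurement.isProjective_ofProjection hQ, hp0, hp1,
    (tensorApply_channel_eq_chi_iff _ _ _ _).2 ⟨h00, h01, h10, h11⟩⟩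

end Projective

/-! ### Block decompositions and projective measurements -/

section Decomposition

variable {a b : Type*} [Fintype a] [Fintype b]

lemma isStarProjection_kronecker {P : Matrix a a ℂ} {Q : Matrix b b ℂ} (hP : IsStarProjection P)
    (hQ : IsStarProjection Q) : IsStarProjection (P ⊗ₖ Q) := by
  refine ⟨?_, ?_⟩
  · rw [IsIdempotentElem, ← Matrix.mul_kronecker_mul, hP.isIdempotentElem.eq,
      hQ.isIdempotentElem.eq]
  · rw [IsSelfAdjoint, Matrix.star_eq_conjTranspose, Matrix.conjTranspose_kronecker]
    exact congrArg₂ _ hP.isSelfAdjoint hQ.isSelfAdjoint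

variable [DecidableEq a] [DecidableEq b]

lemma toEuclideanLin_kronecker_tensorVec (M : Matrix a a ℂ) (N : Matrix b b ℂ)
    (v : EuclideanSpace ℂ a) (w : EuclideanSpace ℂ b) :
    Matrix.toEuclideanLin (M ⊗ₖ N) (tensorVec v w)
      = tensorVec (Matrix.toEuclideanLin M v) (Matrix.toEuclideanLin N w) := by
  ext ⟨i, k⟩
  simp only [tensorVec, Matrix.toLpLin_apply, Matrix.mulVec, dotProduct, Fintype.sum_prod_type,
    Matrix.kronecker_apply, Finset.sum_mul_sum]
  exact Finset.sum_congr rfl fun j _ => Finset.sum_congr rfl fun l _ => by ring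

/-- The range of `M ⊗ N` lies in the tensor product of the ranges. -/
lemma toEuclideanLin_kronecker_mem (M : Matrix a a ℂ) (N : Matrix b b ℂ)
    (u : EuclideanSpace ℂ (a × b)) :
    Matrix.toEuclideanLin (M ⊗ₖ N) u ∈ tensorSubspace
      (LinearMap.range (Matrix.toEuclideanLin M)) (LinearMap.range (Matrix.toEuclideanLin N)) := by
  have hu : u = ∑ p : a × b, u p •
      tensorVec (EuclideanSpace.single p.1 (1 : ℂ)) (EuclideanSpace.single p.2 (1 : ℂ)) := by
    ext ⟨i, k⟩
    simp [tensorVec, Fintype.sum_prod_type]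
  rw [hu, map_sum]
  refine Submodule.sum_mem _ fun p _ => ?_
  rw [map_smul, toEuclideanLin_kronecker_tensorVec]
  exact Submodule.smul_mem _ _ (Submodule.subset_span
    ⟨_, LinearMap.mem_range_self _ _, _, LinearMap.mem_range_self _ _, rfl⟩)

lemma inner_toEuclideanLin {n : Type*} [Fintype n] [DecidableEq n] {P : Matrix n n ℂ}
    (hP : P.IsHermitian) (v w : EuclideanSpace ℂ n) :
    inner ℂ (Matrix.toEuclideanLin P v) w = inner ℂ v (Matrix.toEuclideanLin P w) :=
  Matrix.isSymmetric_toEuclideanLin_iff.2 hP v w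

lemma toEuclideanLin_mul_apply {n : Type*} [Fintype n] [DecidableEq n] (P Q : Matrix n n ℂ)
    (v : EuclideanSpace ℂ n) : Matrix.toEuclideanLin (P * Q) v
      = Matrix.toEuclideanLin P (Matrix.toEuclideanLin Q v) := by
  simp only [Matrix.toLpLin_apply, Matrix.mulVec_mulVec]

/-- Compressing on both sides by product projections gives an operator between the corresponding
tensor products of subspaces. -/
lemma isOperatorBetween_compression {P P' : Matrix a a ℂ} {Q Q' : Matrix b b ℂ}
    (hP : IsStarProjection P) (hQ : IsStarProjection Q) (R : Matrix (a × b) (a × b) ℂ) :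
    IsOperatorBetween ((P' ⊗ₖ Q') * R * (P ⊗ₖ Q))
      (tensorSubspace (LinearMap.range (Matrix.toEuclideanLin P))
        (LinearMap.range (Matrix.toEuclideanLin Q)))
      (tensorSubspace (LinearMap.range (Matrix.toEuclideanLin P'))
        (LinearMap.range (Matrix.toEuclideanLin Q'))) := by
  have hE := isStarProjection_kronecker hP hQ
  refine ⟨fun v hv => ?_, fun v => ?_⟩
  · have h0 : Matrix.toEuclideanLin (P ⊗ₖ Q) v = 0 := by
      rw [← inner_self_eq_zero (𝕜 := ℂ), inner_toEuclideanLin hE.isSelfAdjoint,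
        ← toEuclideanLin_mul_apply, hE.isIdempotentElem.eq, ← inner_conj_symm,
        hv _ (toEuclideanLin_kronecker_mem P Q v), map_zero]
    rw [toEuclideanLin_mul_apply, h0, map_zero]
  · rw [Matrix.mul_assoc, toEuclideanLin_mul_apply]
    exact toEuclideanLin_kronecker_mem P' Q' _

lemma isOrthogonalDecomposition_range {P : Matrix a a ℂ} (hP : IsStarProjection P) :
    IsOrthogonalDecomposition (LinearMap.range (Matrix.toEuclideanLin P))
      (LinearMap.range (Matrix.toEuclideanLin (1 - P))) := by
  constructor
  · rw [Submodule.isOrtho_iff_inner_eq]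
    rintro _ ⟨v, rfl⟩ _ ⟨w, rfl⟩
    rw [inner_toEuclideanLin hP.isSelfAdjoint, ← toEuclideanLin_mul_apply, Matrix.mul_sub,
      Matrix.mul_one, hP.isIdempotentElem.eq, sub_self, map_zero, LinearMap.zero_apply,
      inner_zero_right]
  · rw [eq_top_iff]
    intro v _
    rw [Submodule.mem_sup]
    refine ⟨_, LinearMap.mem_range_self _ v, _, LinearMap.mem_range_self _ v, ?_⟩
    rw [← LinearMap.add_apply, ← map_add, add_sub_cancel, Matrix.toLpLin_one, LinearMap.id_apply]

lemma Measurement.IsProjective.isOrthogonalDecomposition {M : Measurement a}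
    (hM : M.IsProjective) :
    IsOrthogonalDecomposition (LinearMap.range (Matrix.toEuclideanLin (M.effect 0)))
      (LinearMap.range (Matrix.toEuclideanLin (M.effect 1))) := by
  rw [M.effect_one]
  exact isOrthogonalDecomposition_range (hM 0)

/-- The state conditioned on an outcome of positive probability of a projection. -/
noncomputable def State.condition {n : Type*} [Fintype n] (σ : State n) (E : Matrix n n ℂ)
    (hE : IsStarProjection E) (p : ℝ) (hp : 0 < p) (h : (E * σ.mat).trace = p) : State n where
  mat := ((p⁻¹ : ℝ) : ℂ) • (E * σ.mat * E)
  posSemidef := by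
    have h1 := σ.posSemidef.mul_mul_conjTranspose_same E
    rw [← Matrix.star_eq_conjTranspose, hE.isSelfAdjoint.star_eq] at h1
    exact h1.smul (Complex.zero_le_real.2 (inv_nonneg.2 hp.le))
  trace_one := by
    rw [Matrix.trace_smul, Matrix.trace_mul_comm, ← Matrix.mul_assoc, hE.isIdempotentElem.eq, h,
      smul_eq_mul, ← Complex.ofReal_mul, inv_mul_cancel₀ hp.ne', Complex.ofReal_one]

lemma IsOperatorBetween.smul {n : Type*} [Fintype n] [DecidableEq n] {T : Matrix n n ℂ}
    {S S' : Submodule ℂ (EuclideanSpace ℂ n)} (h : IsOperatorBetween T S S') (c : ℂ) :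
    IsOperatorBetween (c • T) S S' := by
  refine ⟨fun v hv => ?_, fun v => ?_⟩
  · rw [map_smul, LinearMap.smul_apply, h.1 v hv, smul_zero]
  · rw [map_smul, LinearMap.smul_apply]
    exact Submodule.smul_mem _ _ (h.2 v)

/-- Outcomes `(0, 1)` and `(1, 0)` have probability zero, so `ρ` lives on the sum of the two
diagonal blocks; the blocks of `ρ` are the data of the decomposition. -/
lemma isDecomposable_of_projective {ρ : State (a × b)} {M : Measurement a} {N : Measurement b}
    {p : ℝ} (hM : M.IsProjective) (hN : N.IsProjective) (hp0 : 0 < p) (hp1 : p < 1)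
    (h : tensorApply M.channel N.channel ρ.mat = chi p) : IsDecomposable ρ := by
  obtain ⟨h00, h01, h10, h11⟩ := (tensorApply_channel_eq_chi_iff _ _ _ _).1 h
  have hM1 := M.effect_one
  have hN1 := N.effect_one
  have hE0 := isStarProjection_kronecker (hM 0) (hN 0)
  have hE1 := isStarProjection_kronecker (hM 1) (hN 1)
  set E₀ := M.effect 0 ⊗ₖ N.effect 0 with hE₀
  set E₁ := M.effect 1 ⊗ₖ N.effect 1 with hE₁
  have hz01 : (M.effect 0 ⊗ₖ N.effect 1) * ρ.mat = 0 := mul_eq_zero_of_trace_eq_zero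
    ((M.posSemidef 0).kronecker (N.posSemidef 1)) ρ.posSemidef h01
  have hz10 : (M.effect 1 ⊗ₖ N.effect 0) * ρ.mat = 0 := mul_eq_zero_of_trace_eq_zero
    ((M.posSemidef 1).kronecker (N.posSemidef 0)) ρ.posSemidef h10
  have hl : (E₀ + E₁) * ρ.mat = ρ.mat := by
    have hone : E₀ + E₁ = 1 - M.effect 0 ⊗ₖ N.effect 1 - M.effect 1 ⊗ₖ N.effect 0 := by
      rw [hE₀, hE₁, hM1, hN1, ← Matrix.one_kronecker_one]
      ext ⟨i, k⟩ ⟨j, l⟩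
      simp only [Matrix.kronecker_apply, Matrix.sub_apply, Matrix.add_apply]
      ring
    rw [hone, Matrix.sub_mul, Matrix.sub_mul, hz01, hz10, Matrix.one_mul, sub_zero, sub_zero]
  have hE0' : E₀ᴴ = E₀ := hE0.isSelfAdjoint
  have hE1' : E₁ᴴ = E₁ := hE1.isSelfAdjoint
  have hρ' : ρ.matᴴ = ρ.mat := ρ.posSemidef.isHermitian
  have hr : ρ.mat * (E₀ + E₁) = ρ.mat := by
    have := congrArg Matrix.conjTranspose hl
    rwa [Matrix.conjTranspose_mul, Matrix.conjTranspose_add, hE0', hE1', hρ'] at this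
  have hq0 : 0 < 1 - p := by linarith
  refine ⟨_, _, _, _, hM.isOrthogonalDecomposition, hN.isOrthogonalDecomposition, p,
    ρ.condition E₀ hE0 p hp0 h00,
    ρ.condition E₁ hE1 (1 - p) hq0 h11, E₁ * ρ.mat * E₀, hp0, hp1,
    (isOperatorBetween_compression (hM 0) (hN 0) ρ.mat).smul _,
    (isOperatorBetween_compression (hM 1) (hN 1) ρ.mat).smul _,
    isOperatorBetween_compression (hM 0) (hN 0) ρ.mat, ?_⟩
  have e0 : (p : ℂ) • (ρ.condition E₀ hE0 p hp0 h00).mat = E₀ * ρ.mat * E₀ := by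
    rw [State.condition, smul_smul, ← Complex.ofReal_mul, mul_inv_cancel₀ hp0.ne',
      Complex.ofReal_one, one_smul]
  have e1 : ((1 - p : ℝ) : ℂ) • (ρ.condition E₁ hE1 (1 - p) hq0 h11).mat = E₁ * ρ.mat * E₁ := by
    rw [State.condition, smul_smul, ← Complex.ofReal_mul, mul_inv_cancel₀ hq0.ne',
      Complex.ofReal_one, one_smul]
  rw [e0, e1, Matrix.conjTranspose_mul, Matrix.conjTranspose_mul, hE0', hE1', hρ',
    ← Matrix.mul_assoc]
  conv_lhs => rw [← hl, ← hr]
  noncomm_ring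

/-- The matrix of the orthogonal projection onto a subspace. -/
noncomputable def projMatrix {n : Type*} [Fintype n] [DecidableEq n]
    (V : Submodule ℂ (EuclideanSpace ℂ n)) : Matrix n n ℂ :=
  (Matrix.toEuclideanCLM (n := n) (𝕜 := ℂ)).symm V.starProjection

section ProjMatrix

variable {n : Type*} [Fintype n] [DecidableEq n]

lemma toEuclideanLin_projMatrix (V : Submodule ℂ (EuclideanSpace ℂ n))
    (v : EuclideanSpace ℂ n) : Matrix.toEuclideanLin (projMatrix V) v = V.starProjection v := by
  have h : Matrix.toEuclideanCLM (n := n) (𝕜 := ℂ) (projMatrix V) = V.starProjection :=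
    StarAlgEquiv.apply_symm_apply _ _
  exact congrArg (fun T : EuclideanSpace ℂ n →L[ℂ] EuclideanSpace ℂ n => T v) h

lemma isStarProjection_projMatrix (V : Submodule ℂ (EuclideanSpace ℂ n)) :
    IsStarProjection (projMatrix V) := by
  have h : IsStarProjection V.starProjection := isStarProjection_starProjection
  refine ⟨?_, ?_⟩
  · rw [IsIdempotentElem, projMatrix, ← map_mul, h.isIdempotentElem.eq]
  · refine (Matrix.isSymmetric_toEuclideanLin_iff (A := projMatrix V)).1 fun v w => ?_
    rw [toEuclideanLin_projMatrix, toEuclideanLin_projMatrix,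
      Submodule.inner_starProjection_left_eq_right]

lemma projMatrix_apply_of_mem {V : Submodule ℂ (EuclideanSpace ℂ n)} {v : EuclideanSpace ℂ n}
    (hv : v ∈ V) : Matrix.toEuclideanLin (projMatrix V) v = (1 : ℂ) • v := by
  rw [toEuclideanLin_projMatrix, one_smul, Submodule.starProjection_eq_self_iff.2 hv]

lemma projMatrix_apply_of_isOrtho {V V' : Submodule ℂ (EuclideanSpace ℂ n)} (hV : V ⟂ V')
    {v : EuclideanSpace ℂ n} (hv : v ∈ V') :
    Matrix.toEuclideanLin (projMatrix V) v = (0 : ℂ) • v := by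
  rw [toEuclideanLin_projMatrix, zero_smul, Submodule.starProjection_apply_eq_zero_iff]
  exact hV.ge hv

lemma one_sub_projMatrix {V₀ V₁ : Submodule ℂ (EuclideanSpace ℂ n)}
    (h : IsOrthogonalDecomposition V₀ V₁) : 1 - projMatrix V₀ = projMatrix V₁ := by
  have hV : V₁ = V₀ᗮ := by
    refine le_antisymm h.1.ge fun v hv => ?_
    obtain ⟨x, hx, y, hy, rfl⟩ := Submodule.mem_sup.1 (h.2 ▸ Submodule.mem_top : v ∈ V₀ ⊔ V₁)
    have h0 : inner ℂ x (x + y) = 0 := hv x hx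
    rw [inner_add_right, h.1.ge hy x hx, add_zero, inner_self_eq_zero] at h0
    rwa [h0, zero_add]
  rw [hV, projMatrix, projMatrix, Submodule.starProjection_orthogonal', map_sub, map_one]

end ProjMatrix

/-- Product projections annihilate or fix the operators with values in `V ⊗ W`. -/
lemma kronecker_mul_of_forall_mem {P : Matrix a a ℂ} {Q : Matrix b b ℂ} {c d : ℂ}
    {V : Submodule ℂ (EuclideanSpace ℂ a)} {W : Submodule ℂ (EuclideanSpace ℂ b)}
    (hP : ∀ v ∈ V, Matrix.toEuclideanLin P v = c • v)
    (hQ : ∀ w ∈ W, Matrix.toEuclideanLin Q w = d • w) {T : Matrix (a × b) (a × b) ℂ}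
    (hT : ∀ u, Matrix.toEuclideanLin T u ∈ tensorSubspace V W) :
    (P ⊗ₖ Q) * T = (c * d) • T := by
  have key : ∀ u ∈ tensorSubspace V W, Matrix.toEuclideanLin (P ⊗ₖ Q) u = (c * d) • u := by
    intro u hu
    induction hu using Submodule.span_induction with
    | mem u hu =>
      obtain ⟨v, hv, w, hw, rfl⟩ := hu
      rw [toEuclideanLin_kronecker_tensorVec, hP v hv, hQ w hw]
      ext ⟨i, k⟩
      simp only [tensorVec, PiLp.smul_apply, smul_eq_mul]
      ring
    | zero => simp
    | add u v _ _ hu hv => rw [map_add, hu, hv, smul_add]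
    | smul x u _ hu => rw [map_smul, hu, smul_comm]
  apply Matrix.toEuclideanLin.injective
  refine LinearMap.ext fun u => ?_
  rw [toEuclideanLin_mul_apply, key _ (hT u), map_smul, LinearMap.smul_apply]

lemma exists_measurement_of_isDecomposable {ρ : State (a × b)} (h : IsDecomposable ρ) :
    ∃ (M : Measurement a) (N : Measurement b) (p : ℝ), 0 < p ∧ p < 1 ∧
      tensorApply M.channel N.channel ρ.mat = chi p := by
  obtain ⟨A₀, A₁, B₀, B₁, hA, hB, p, ρ₀, ρ₁, X, hp0, hp1, h₀, h₁, hX, hρ⟩ := h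
  have hA' := one_sub_projMatrix hA
  have hB' := one_sub_projMatrix hB
  have htr : ∀ (E : Matrix (a × b) (a × b) ℂ) (α β γ : ℂ), E.IsHermitian →
      E * ρ₀.mat = α • ρ₀.mat → E * ρ₁.mat = β • ρ₁.mat → E * X = γ • X →
      (E * ρ.mat).trace = p * α + (1 - p : ℝ) * β + (γ * X.trace + star (γ * X.trace)) := by
    intro E α β γ hE e0 e1 eX
    have eX' : (E * Xᴴ).trace = star (E * X).trace := by
      rw [← Matrix.trace_conjTranspose, Matrix.conjTranspose_mul, hE.eq, Matrix.trace_mul_comm]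
    rw [hρ, Matrix.mul_add, Matrix.mul_add, Matrix.mul_add, Matrix.trace_add, Matrix.trace_add,
      Matrix.trace_add, eX', eX, Matrix.mul_smul, Matrix.mul_smul, e0, e1]
    simp only [Matrix.trace_smul, ρ₀.trace_one, ρ₁.trace_one, smul_eq_mul, mul_one]
    ring
  -- the trace of `ρ` forces the real part of `Tr X` to vanish
  have hXtr : X.trace + star X.trace = 0 := by
    have := htr 1 1 1 1 Matrix.isHermitian_one (by simp) (by simp) (by simp)
    rw [Matrix.one_mul, ρ.trace_one, one_mul] at this
    push_cast at this
    linear_combination -this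
  have hEh : ∀ (V : Submodule ℂ (EuclideanSpace ℂ a)) (W : Submodule ℂ (EuclideanSpace ℂ b)),
      (projMatrix V ⊗ₖ projMatrix W).IsHermitian := fun V W =>
    (isStarProjection_kronecker (isStarProjection_projMatrix V)
      (isStarProjection_projMatrix W)).isSelfAdjoint
  have a00 := fun (v) (hv : v ∈ A₀) => projMatrix_apply_of_mem hv
  have a11 := fun (v) (hv : v ∈ A₁) => projMatrix_apply_of_mem hv
  have a01 := fun (v) (hv : v ∈ A₁) => projMatrix_apply_of_isOrtho hA.1 hv
  have a10 := fun (v) (hv : v ∈ A₀) => projMatrix_apply_of_isOrtho hA.1.symm hv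
  have b00 := fun (v) (hv : v ∈ B₀) => projMatrix_apply_of_mem hv
  have b11 := fun (v) (hv : v ∈ B₁) => projMatrix_apply_of_mem hv
  have b01 := fun (v) (hv : v ∈ B₁) => projMatrix_apply_of_isOrtho hB.1 hv
  have b10 := fun (v) (hv : v ∈ B₀) => projMatrix_apply_of_isOrtho hB.1.symm hv
  refine ⟨.ofProjection _ (isStarProjection_projMatrix A₀),
    .ofProjection _ (isStarProjection_projMatrix B₀), p, hp0, hp1,
    (tensorApply_channel_eq_chi_iff _ _ _ _).2 ?_⟩
  change ((projMatrix A₀ ⊗ₖ projMatrix B₀) * ρ.mat).trace = p ∧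
    ((projMatrix A₀ ⊗ₖ (1 - projMatrix B₀)) * ρ.mat).trace = 0 ∧
    (((1 - projMatrix A₀) ⊗ₖ projMatrix B₀) * ρ.mat).trace = 0 ∧
    (((1 - projMatrix A₀) ⊗ₖ (1 - projMatrix B₀)) * ρ.mat).trace = ((1 - p : ℝ) : ℂ)
  rw [hA', hB']
  refine ⟨?_, ?_, ?_, ?_⟩
  · rw [htr _ _ _ _ (hEh _ _) (kronecker_mul_of_forall_mem a00 b00 h₀.2)
      (kronecker_mul_of_forall_mem a01 b01 h₁.2) (kronecker_mul_of_forall_mem a01 b01 hX.2)]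
    simp
  · rw [htr _ _ _ _ (hEh _ _) (kronecker_mul_of_forall_mem a00 b10 h₀.2)
      (kronecker_mul_of_forall_mem a01 b11 h₁.2) (kronecker_mul_of_forall_mem a01 b11 hX.2)]
    simp
  · rw [htr _ _ _ _ (hEh _ _) (kronecker_mul_of_forall_mem a10 b00 h₀.2)
      (kronecker_mul_of_forall_mem a11 b01 h₁.2) (kronecker_mul_of_forall_mem a11 b01 hX.2)]
    simp
  · rw [htr _ _ _ _ (hEh _ _) (kronecker_mul_of_forall_mem a10 b10 h₀.2)
      (kronecker_mul_of_forall_mem a11 b11 h₁.2) (kronecker_mul_of_forall_mem a11 b11 hX.2)]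
    simp only [mul_one, mul_zero, zero_add, one_mul, hXtr, add_zero]

end Decomposition

end QMaxCorr

theorem mainTheorem4 {a b : Type*} [Fintype a] [DecidableEq a] [Fintype b] [DecidableEq b]
    (ρ : State (a × b)) :
    (∀ f : ℝ → ℝ, IsNormalizedOperatorMonotone f →
      (BddAbove (valuesHerm f ρ) ∧ 0 ≤ mu f ρ ∧
        (mu f ρ = 0 ↔ ρ.mat = ρ.margA.mat ⊗ₖ ρ.margB.mat)) ∧
      (BddAbove (valuesLin f ρ) ∧ 0 ≤ muLin f ρ ∧
        (muLin f ρ = 0 ↔ ρ.mat = ρ.margA.mat ⊗ₖ ρ.margB.mat))) ∧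
    (∀ f : ℝ → ℝ, IsNormalizedOperatorMonotone f → (∀ x : ℝ, 0 < x → fGM x ≤ f x) →
      mu f ρ ≤ muLin f ρ ∧ muLin f ρ ≤ 1) ∧
    List.TFAE [
      mu fAM ρ = 1,
      ∃ (M : Measurement a) (N : Measurement b) (p : ℝ), 0 < p ∧ p < 1 ∧
        tensorApply M.channel N.channel ρ.mat = chi p,
      ∃ (M : Measurement a) (N : Measurement b) (p : ℝ), M.IsProjective ∧ N.IsProjective ∧
        0 < p ∧ p < 1 ∧ tensorApply M.channel N.channel ρ.mat = chi p,
      IsDecomposable ρ] := by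
  refine ⟨fun f hf => ⟨⟨bddAbove_valuesHerm hf ρ, mu_nonneg f ρ, product_of_mu_eq_zero hf,
    fun h => ?_⟩, bddAbove_valuesLin hf ρ, muLin_nonneg f ρ, fun h => ?_,
    muLin_eq_zero_of_product hf.normalized⟩, fun f hf hgm => ⟨mu_le_muLin hf ρ, ?_⟩, ?_⟩
  · exact le_antisymm ((mu_le_muLin hf ρ).trans
      (muLin_eq_zero_of_product hf.normalized h).le) (mu_nonneg f ρ)
  · exact product_of_mu_eq_zero hf (le_antisymm ((mu_le_muLin hf ρ).trans h.le) (mu_nonneg f ρ))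
  · exact muLin_le_one fun x y hx hy => hf.sqrt_mul_le_perspective hgm hx hy
  · tfae_have 1 → 3 := exists_projective_of_mu_eq_one
    tfae_have 3 → 2 := fun ⟨M, N, p, _, _, hp0, hp1, h⟩ => ⟨M, N, p, hp0, hp1, h⟩
    tfae_have 2 → 1 := fun ⟨_, _, _, hp0, hp1, h⟩ => mu_fAM_eq_one_of_measurement hp0 hp1 h
    tfae_have 3 → 4 := fun ⟨_, _, _, hM, hN, hp0, hp1, h⟩ =>
      isDecomposable_of_projective hM hN hp0 hp1 h
    tfae_have 4 → 2 := exists_measurement_of_isDecomposable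
    tfae_finish
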